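/- **Setting.** Let $\mathbb C$ be a small category and $\mathcal E=\mathrm{Psh}(\mathbb C)$. Let $\mathcal E^\to$ be the category of arrows and commutative squares of $\mathcal E$, and $\mathcal E^\to_{\mathrm{cart}}$ its subcategory of all arrows and pullback squares. Let $I\otimes(-)\colon\mathcal E\to\mathcal E$ be a functorial cylinder, with endpoint inclusions $\delta^0\otimes(-),\delta^1\otimes(-)\colon \mathrm{Id}\to I\otimes(-)$. Suppose that it has contractions, i.e. a natural transformation $\varepsilon\otimes(-)\colon I\otimes(-)\to\mathrm{Id}$ that is a common retraction of the endpoint inclusions, and connections, i.e. natural transformations $c^k\otimes(-)\colon I\otimes I\otimes(-)\to I\otimes(-)$ for $k\in\{0,1\}$ with $$c^k\circ(\delta^k\otimes I\otimes X)=c^k\circ(I\otimes\delta^k\otimes X)=(\delta^k\otimes X)\circ(\varepsilon\otimes X),\qquad c^k\circ(\delta^{1-k}\otimes I\otimes X)=c^k\circ(I\otimes\delta^{1-k}\otimes X)=\mathrm{id}_{I\otimes X}.$$ Suppose also that $I\otimes(-)$ has a right adjoint, and that * (C1) $I\otimes(-)$ preserves pullback squares; * (C2) the natural transformations $\delta^k\otimes(-)$,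 $k\in\{0,1\}$, are cartesian, i.e. all their naturality squares are pullbacks. For $i\colon A\to B$ and $k\in\{0,1\}$, the Leibniz product $\delta^k\mathbin{\hat\otimes} i\colon (I\otimes A)+_A B\to I\otimes B$ is the map induced by $I\otimes i$ and $\delta^k\otimes B$ from the pushout of $\delta^k\otimes A$ and $i$. Let $\mathcal M$ be a full subcategory of $\mathcal E^\to_{\mathrm{cart}}$ such that * (M1) all elements of $\mathcal M$ are monomorphisms; * (M2) for every $X\in\mathcal E$ the map $\bot_X\colon 0\to X$ is in $\mathcal M$; * (M3) the elements of $\mathcal M$ are closed under pullback; * (M4) the elements of $\mathcal M$ are closed under $\delta^k\mathbin{\hat\otimes}(-)$ for $k\in\{0,1\}$. **Definitions.** For a functor $u\colon\mathcal I\to\mathcal E^\to$, $u_i\colon A_i\to B_i$, the category $\mathcal I^{\pitchfork}$ has as objects the maps $f\colon X\to Y$ of $\mathcal E$ equipped with a diagonal filler $\phi(i,s,t)\colon B_i\to X$ for each $i\in\mathcal I$ and each commuting square $(s,t)\colon u_i\to f$, such that $\phi(j,s,t)\circ b=\phi(i,s\circ a,t\circ b)$ whenever $(a,b)\colon u_i\to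 u_j$ is the image under $u$ of a map $i\to j$; its morphisms are the squares that commute with the chosen fillers. An algebraic weak factorization system (awfs) $(\mathsf L,\mathsf R)$ on $\mathcal E$ is a functorial factorization $f=\mathsf Rf\circ\mathsf Lf$ of the maps of $\mathcal E$ together with natural transformations $\mathsf L\to\mathsf L\mathsf L$ and $\mathsf R\mathsf R\to\mathsf R$ which make $\mathsf L$, with its canonical copointing $(\mathrm{id},\mathsf R)\colon\mathsf L\to\mathrm{Id}$, a comonad on $\mathcal E^\to$ and $\mathsf R$, with its canonical pointing $(\mathsf L,\mathrm{id})\colon\mathrm{Id}\to\mathsf R$, a monad on $\mathcal E^\to$, such that the canonical natural transformation $\mathsf L\mathsf R\to\mathsf R\mathsf L$ is a distributive law. It is algebraically-free on $u\colon\mathcal I\to\mathcal E^\to$ if its category of $\mathsf R$-monad algebras is isomorphic to $\mathcal I^{\pitchfork}$ over $\mathcal E^\to$. It is cofibrantly generated if it is algebraically-free on some $u\colon\mathcal I\to\mathcal E^\to$ with $\mathcal I$ small. For an awfs $(\mathsf C,\mathsf F_{\mathsf t})$ write $\mathsf{Cof}$ for the category of coalgebras for the copointed endofunctor $\mathsf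 C$, and $\mathsf{TrivFib}$ for the category of algebras for the monad $\mathsf F_{\mathsf t}$. The awfs is suitable if * (S1) it is cofibrantly generated; * (S2) the functor $\bot\colon\mathcal E\to\mathcal E^\to$, $X\mapsto(\bot_X\colon 0\to X)$, factors through the forgetful functor $\mathsf{Cof}\to\mathcal E^\to$; * (S3) the pullback functor $P\colon\mathcal E^\to\times_{\mathcal E}\mathcal E^\to\to\mathcal E^\to$, $(g,h)\mapsto h^*g$, defined on pairs of arrows with common codomain, lifts to a functor $\mathsf{Cof}\times_{\mathcal E}\mathcal E^\to\to\mathsf{Cof}$ over the forgetful functors; * (S4) for $k\in\{0,1\}$ the functor $\delta^k\mathbin{\hat\otimes}(-)\colon\mathcal E^\to\to\mathcal E^\to$ lifts to a functor $\mathsf{Cof}\to\mathsf{Cof}$ over the forgetful functors. **Theorem.** There exists a suitable awfs $(\mathsf C,\mathsf F_{\mathsf t})$ on $\mathcal E$ that is algebraically-free on the inclusion $\mathcal M\to\mathcal E^\to$, i.e. such that $\mathsf{TrivFib}\cong\mathcal M^{\pitchfork}$ over $\mathcal E^\to$. -/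

import Mathlib

open CategoryTheory Limits

universe w v u v₁ u₁ v₂ u₂

noncomputable section

namespace UniformFibrations

/-! ### Functorial cylinders -/

/-- A functorial cylinder on `E`: an endofunctor `I ⊗ (-)` together with two endpoint inclusions
`δ⁰ ⊗ (-), δ¹ ⊗ (-) : Id ⟶ I ⊗ (-)`. -/
structure FunctorialCylinder (E : Type u) [Category.{v} E] where
  /-- the endofunctor `I ⊗ (-)` -/
  cyl : E ⥤ E
  /-- the endpoint inclusions -/
  δ : Fin 2 → (𝟭 E ⟶ cyl)

/-- Contractions: a common retraction `ε ⊗ (-)` of the two endpoint inclusions. -/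
structure FunctorialCylinder.Contractions {E : Type u} [Category.{v} E]
    (Cyl : FunctorialCylinder E) where
  /-- the common retraction -/
  ε : Cyl.cyl ⟶ 𝟭 E
  δ_ε : ∀ k : Fin 2, Cyl.δ k ≫ ε = 𝟙 (𝟭 E)

/-- Connections `cᵏ ⊗ (-) : I ⊗ I ⊗ (-) ⟶ I ⊗ (-)`, for `k = 0, 1`, on a functorial cylinder with
contractions. In `Fin 2`, `1 - k` is the other endpoint. -/
structure FunctorialCylinder.Connections {E : Type u} [Category.{v} E]
    {Cyl : FunctorialCylinder E} (K : Cyl.Contractions) where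
  /-- the connection operations -/
  c : Fin 2 → (Cyl.cyl ⋙ Cyl.cyl ⟶ Cyl.cyl)
  /-- `cᵏ ∘ (δᵏ ⊗ I ⊗ X) = δᵏ ∘ ε` -/
  δ_cyl_c : ∀ (k : Fin 2) (X : E),
    (Cyl.δ k).app (Cyl.cyl.obj X) ≫ (c k).app X = K.ε.app X ≫ (Cyl.δ k).app X
  /-- `cᵏ ∘ (I ⊗ δᵏ ⊗ X) = δᵏ ∘ ε` -/
  cyl_δ_c : ∀ (k : Fin 2) (X : E),
    Cyl.cyl.map ((Cyl.δ k).app X) ≫ (c k).app X = K.ε.app X ≫ (Cyl.δ k).app X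
  /-- `cᵏ ∘ (δ¹⁻ᵏ ⊗ I ⊗ X) = id` -/
  δ_cyl_c' : ∀ (k : Fin 2) (X : E),
    (Cyl.δ (1 - k)).app (Cyl.cyl.obj X) ≫ (c k).app X = 𝟙 (Cyl.cyl.obj X)
  /-- `cᵏ ∘ (I ⊗ δ¹⁻ᵏ ⊗ X) = id` -/
  cyl_δ_c' : ∀ (k : Fin 2) (X : E),
    Cyl.cyl.map ((Cyl.δ (1 - k)).app X) ≫ (c k).app X = 𝟙 (Cyl.cyl.obj X)

/-- The Leibniz product functor `δᵏ ⊗̂ (-)` on arrows, for the evaluation bifunctor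
`(E ⥤ E) ⥤ (E ⥤ E)`: it sends `i : A ⟶ B` to the map `(I ⊗ A) +_A B ⟶ I ⊗ B` induced by
`I ⊗ i` and `δᵏ ⊗ B` out of the pushout of `δᵏ ⊗ A` and `i`. -/
def FunctorialCylinder.leibniz {E : Type u} [Category.{v} E] [HasPushouts E]
    (Cyl : FunctorialCylinder E) (k : Fin 2) : Arrow E ⥤ Arrow E :=
  (𝟭 (E ⥤ E)).leibnizPushout.obj (Arrow.mk (Cyl.δ k))

/-! ### The category of arrows and pullback squares -/

/-- The class of those morphisms of the arrow category which are pullback squares. -/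
def cartesianSquares (E : Type u) [Category.{v} E] : MorphismProperty (Arrow E) :=
  fun f g sq => IsPullback sq.left f.hom g.hom sq.right

instance (E : Type u) [Category.{v} E] : (cartesianSquares E).IsMultiplicative where
  id_mem f := IsPullback.of_horiz_isIso ⟨by simp⟩
  comp_mem _ _ h h' := IsPullback.paste_horiz h h'

/-- The category of arrows of `E` and pullback squares. -/
abbrev CartArrow (E : Type u) [Category.{v} E] := WideSubcategory (cartesianSquares E)

/-- A class of maps of `E`, viewed as a full subcategory of the category of arrows and pullback
squares. -/
abbrev CartSubcategory {E : Type u} [Category.{v} E] (M : MorphismProperty E) :=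
  ObjectProperty.FullSubcategory (C := CartArrow E) (fun f => M f.obj.hom)

/-- The inclusion of the full subcategory of arrows and pullback squares spanned by `M` into the
category of arrows. -/
abbrev CartSubcategory.incl {E : Type u} [Category.{v} E] (M : MorphismProperty E) :
    CartSubcategory M ⥤ Arrow E :=
  ObjectProperty.ι (C := CartArrow E) (fun f => M f.obj.hom) ⋙
    wideSubcategoryInclusion (cartesianSquares E)

/-! ### Right orthogonals -/

/-- A right `u`-map, for `u : I ⥤ Arrow E`: an arrow together with a choice of a diagonal filler for
every square from some `u.obj i` to it, naturally in `i`. -/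
structure RightMap {I : Type u₁} [Category.{v₁} I] {E : Type u} [Category.{v} E]
    (u : I ⥤ Arrow E) where
  /-- the underlying arrow -/
  arrow : Arrow E
  /-- the chosen fillers -/
  lift : ∀ (i : I) (_ : u.obj i ⟶ arrow), (u.obj i).right ⟶ arrow.left
  fac_left : ∀ (i : I) (sq : u.obj i ⟶ arrow), (u.obj i).hom ≫ lift i sq = sq.left
  fac_right : ∀ (i : I) (sq : u.obj i ⟶ arrow), lift i sq ≫ arrow.hom = sq.right
  naturality : ∀ {i j : I} (σ : i ⟶ j) (sq : u.obj j ⟶ arrow),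
    (u.map σ).right ≫ lift j sq = lift i (u.map σ ≫ sq)

namespace RightMap

variable {I : Type u₁} [Category.{v₁} I] {E : Type u} [Category.{v} E] {u : I ⥤ Arrow E}

/-- A morphism of right `u`-maps: a square compatible with the chosen fillers. -/
@[ext]
structure Hom (f g : RightMap u) where
  /-- the underlying square -/
  sq : f.arrow ⟶ g.arrow
  lift_comp : ∀ (i : I) (s : u.obj i ⟶ f.arrow), f.lift i s ≫ sq.left = g.lift i (s ≫ sq)

instance : Category (RightMap u) where
  Hom := Hom
  id f := ⟨𝟙 f.arrow, fun i s => by simp⟩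
  comp α β := ⟨α.sq ≫ β.sq, fun i s => by
    rw [Arrow.comp_left, ← Category.assoc, α.lift_comp, β.lift_comp, Category.assoc]⟩

variable (u) in
/-- The right orthogonal of `u`: the forgetful functor from right `u`-maps to arrows. -/
def forget : RightMap u ⥤ Arrow E where
  obj f := f.arrow
  map α := Hom.sq α

end RightMap

/-! ### Algebraic weak factorization systems -/

/-- Functorial factorizations of all maps of `E`. -/
abbrev FunctorialFactorization (E : Type u) [Category.{v} E] :=
  MorphismProperty.FunctorialFactorizationData (⊤ : MorphismProperty E) (⊤ : MorphismProperty E)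

namespace FunctorialFactorization

variable {E : Type u} [Category.{v} E] (F : FunctorialFactorization E)

/-- The left functor `L` of a functorial factorization. -/
@[simps]
def L : Arrow E ⥤ Arrow E where
  obj f := Arrow.mk (X := f.left) (Y := F.Z.obj f) (F.i.app f)
  map {f g} φ := Arrow.homMk (u := φ.left) (v := F.Z.map φ) (F.i.naturality φ)

/-- The right functor `R` of a functorial factorization. -/
@[simps]
def R : Arrow E ⥤ Arrow E where
  obj f := Arrow.mk (X := F.Z.obj f) (Y := f.right) (F.p.app f)
  map {f g} φ := Arrow.homMk (u := F.Z.map φ) (v := φ.right) (F.p.naturality φ)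

/-- The canonical copointing `(id, R) : L ⟶ Id`. -/
@[simps]
def counit : F.L ⟶ 𝟭 (Arrow E) where
  app f := Arrow.homMk (f := F.L.obj f) (g := f) (u := 𝟙 f.left) (v := F.p.app f)
    ((Category.id_comp f.hom).trans F.fac_app.symm)
  naturality f g φ := by
    ext
    · exact (Category.comp_id φ.left).trans (Category.id_comp φ.left).symm
    · exact F.p.naturality φ

/-- The canonical pointing `(L, id) : Id ⟶ R`. -/
@[simps]
def unit : 𝟭 (Arrow E) ⟶ F.R where
  app f := Arrow.homMk (f := f) (g := F.R.obj f) (u := F.i.app f) (v := 𝟙 f.right)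
    (F.fac_app.trans (Category.comp_id f.hom).symm)
  naturality f g φ := by
    ext
    · exact F.i.naturality φ
    · exact (Category.comp_id φ.right).trans (Category.id_comp φ.right).symm

end FunctorialFactorization

/-- A distributive law of a comonad `G` over a monad `T`: a natural transformation
`G T ⟶ T G` compatible with the unit, the counit, the multiplication and the comultiplication. -/
structure IsDistributiveLaw {A : Type u} [Category.{v} A] (G : Comonad A) (T : Monad A)
    (d : T.toFunctor ⋙ G.toFunctor ⟶ G.toFunctor ⋙ T.toFunctor) : Prop where
  unit : ∀ X : A, G.map (T.η.app X) ≫ d.app X = T.η.app (G.obj X)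
  counit : ∀ X : A, d.app X ≫ T.map (G.ε.app X) = G.ε.app (T.obj X)
  mul : ∀ X : A,
    G.map (T.μ.app X) ≫ d.app X = d.app (T.obj X) ≫ T.map (d.app X) ≫ T.μ.app (G.obj X)
  comul : ∀ X : A,
    d.app X ≫ T.map (G.δ.app X) = G.δ.app (T.obj X) ≫ G.map (d.app X) ≫ d.app (G.obj X)

/-- A functorial factorization together with a comultiplication making the copointed endofunctor
`L` a comonad and a multiplication making the pointed endofunctor `R` a monad. -/
structure PreAWFS (E : Type u) [Category.{v} E] where
  /-- the underlying functorial factorization -/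
  fact : FunctorialFactorization E
  /-- the comultiplication `L ⟶ L L` -/
  comul : fact.L ⟶ fact.L ⋙ fact.L
  /-- the multiplication `R R ⟶ R` -/
  mul : fact.R ⋙ fact.R ⟶ fact.R
  coassoc : ∀ f, comul.app f ≫ fact.L.map (comul.app f) =
    comul.app f ≫ comul.app (fact.L.obj f)
  left_counit : ∀ f, comul.app f ≫ fact.counit.app (fact.L.obj f) = 𝟙 (fact.L.obj f)
  right_counit : ∀ f, comul.app f ≫ fact.L.map (fact.counit.app f) = 𝟙 (fact.L.obj f)
  assoc : ∀ f, fact.R.map (mul.app f) ≫ mul.app f = mul.app (fact.R.obj f) ≫ mul.app f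
  left_unit : ∀ f, fact.unit.app (fact.R.obj f) ≫ mul.app f = 𝟙 (fact.R.obj f)
  right_unit : ∀ f, fact.R.map (fact.unit.app f) ≫ mul.app f = 𝟙 (fact.R.obj f)

namespace PreAWFS

variable {E : Type u} [Category.{v} E] (W : PreAWFS E)

/-- The comonad on `L`. -/
def comonad : Comonad (Arrow E) where
  toFunctor := W.fact.L
  ε := W.fact.counit
  δ := W.comul
  coassoc := W.coassoc
  left_counit := W.left_counit
  right_counit := W.right_counit

/-- The monad on `R`. -/
def monad : Monad (Arrow E) where
  toFunctor := W.fact.R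
  η := W.fact.unit
  μ := W.mul
  assoc := W.assoc
  left_unit := W.left_unit
  right_unit := W.right_unit

/-- The canonical transformation `L R ⟶ R L`: at `f`, it is the square from `L (R f)` to `R (L f)`
with top the codomain component of the comultiplication at `f` and bottom the domain component of
the multiplication at `f`. Both composites of this square are the identity. -/
def canonical : W.fact.R ⋙ W.fact.L ⟶ W.fact.L ⋙ W.fact.R where
  app f := Arrow.homMk (f := W.fact.L.obj (W.fact.R.obj f)) (g := W.fact.R.obj (W.fact.L.obj f))
    (u := (W.comul.app f).right) (v := (W.mul.app f).left) (by
      have h₁ := congrArg CommaMorphism.right (W.left_counit f)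
      have h₂ := congrArg CommaMorphism.left (W.left_unit f)
      exact h₁.trans h₂.symm)
  naturality f g φ := by
    ext
    · exact congrArg CommaMorphism.right (W.comul.naturality φ)
    · exact congrArg CommaMorphism.left (W.mul.naturality φ)

end PreAWFS

/-- An algebraic weak factorization system on `E`. -/
structure AWFS (E : Type u) [Category.{v} E] extends PreAWFS E where
  distrib : IsDistributiveLaw toPreAWFS.comonad toPreAWFS.monad toPreAWFS.canonical

namespace AWFS

variable {E : Type u} [Category.{v} E] (W : AWFS E)

/-- The category of coalgebras for the copointed endofunctor `L`: coalgebras for the endofunctor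
whose structure map is a section of the copointing. Coassociativity is not required. -/
abbrev Cof :=
  ObjectProperty.FullSubcategory (C := Endofunctor.Coalgebra W.fact.L)
    (fun c => c.str ≫ W.fact.counit.app c.V = 𝟙 c.V)

/-- The forgetful functor from `Cof` to arrows. -/
abbrev cofForget : W.Cof ⥤ Arrow E :=
  ObjectProperty.ι (C := Endofunctor.Coalgebra W.fact.L)
    (fun c => c.str ≫ W.fact.counit.app c.V = 𝟙 c.V) ⋙ Endofunctor.Coalgebra.forget W.fact.L

/-- The category of algebras for the monad `R`. -/
abbrev TrivFib := W.monad.Algebra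

/-- The forgetful functor from `TrivFib` to arrows. -/
abbrev trivFibForget : W.TrivFib ⥤ Arrow E := W.monad.forget

end AWFS

/-- Isomorphism of categories over `B`. -/
def IsoOver {B : Type u} [Category.{v} B] {J : Type u₁} [Category.{v₁} J] {K : Type u₂}
    [Category.{v₂} K] (U : J ⥤ B) (V : K ⥤ B) : Prop :=
  ∃ (F : J ⥤ K) (G : K ⥤ J), F ⋙ G = 𝟭 J ∧ G ⋙ F = 𝟭 K ∧ F ⋙ V = U

/-- The awfs is algebraically-free on `u : I ⥤ Arrow E`: its category of monad algebras is
isomorphic, over the category of arrows, to the category of right `u`-maps. -/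
def AWFS.AlgebraicallyFree {E : Type u} [Category.{v} E] (W : AWFS E)
    {I : Type u₁} [Category.{v₁} I] (u : I ⥤ Arrow E) : Prop :=
  IsoOver W.trivFibForget (RightMap.forget u)

/-- The awfs is cofibrantly generated: it is algebraically-free on a small category of arrows.
Small means small relative to the universe `w`. -/
def AWFS.CofibrantlyGenerated {E : Type u} [Category.{v} E] (W : AWFS E) : Prop :=
  ∃ (I : Type w) (_ : SmallCategory I) (u : I ⥤ Arrow E), W.AlgebraicallyFree u

/-! ### Suitable algebraic weak factorization systems -/

/-- The functor sending `X` to the unique map `0 ⟶ X`. -/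
def botFunctor (E : Type u) [Category.{v} E] [HasInitial E] : E ⥤ Arrow E where
  obj X := Arrow.mk (initial.to X)
  map {X Y} f := Arrow.homMk (f := Arrow.mk (initial.to X)) (g := Arrow.mk (initial.to Y))
    (u := 𝟙 (⊥_ E)) (v := f) (by simp)

/-- For `U : J ⥤ Arrow E`, the category `J ×_E Arrow E` of pairs consisting of an object `j` of `J`
and a map `h : Y ⟶ B` into the codomain of `U.obj j : A ⟶ B`. -/
abbrev CospanOver {E : Type u} [Category.{v} E] {J : Type u₁} [Category.{v₁} J]
    (U : J ⥤ Arrow E) := Comma (𝟭 E) (U ⋙ Arrow.rightFunc)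

/-- The pullback functor `P`, sending a cospan `(g : A ⟶ B, h : Y ⟶ B)` to the arrow
`h^* g : A ×_B Y ⟶ Y`. -/
def pullbackFunctor (E : Type u) [Category.{v} E] [HasPullbacks E] :
    Comma (𝟭 E) (Arrow.rightFunc : Arrow E ⥤ E) ⥤ Arrow E where
  obj c := Arrow.mk (X := pullback c.right.hom c.hom) (Y := c.left)
    (pullback.snd c.right.hom c.hom)
  map {c d} φ := Arrow.homMk
    (f := Arrow.mk (pullback.snd c.right.hom c.hom))
    (g := Arrow.mk (pullback.snd d.right.hom d.hom))
    (u := pullback.map c.right.hom c.hom d.right.hom d.hom φ.right.left φ.left φ.right.right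
      (Arrow.w φ.right).symm φ.w.symm)
    (v := φ.left) (pullback.lift_snd _ _ _)
  map_id c := by
    ext
    · exact pullback.map_id
    · rfl
  map_comp φ ψ := by
    ext
    · exact (pullback.map_comp (i₃ := φ.right.right) (j₃ := ψ.right.right)
        (e₁ := (Arrow.w φ.right).symm) (e₂ := φ.w.symm)
        (e₃ := (Arrow.w ψ.right).symm) (e₄ := ψ.w.symm) ..).symm
    · rfl

/-- An awfs is suitable (with respect to a functorial cylinder) if it is cofibrantly generated and
if the functors `⊥`, pullback, and Leibniz product with the endpoint inclusions lift to `Cof`. -/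
structure AWFS.IsSuitable {E : Type u} [Category.{v} E] [HasInitial E] [HasPullbacks E]
    [HasPushouts E] (W : AWFS E) (Cyl : FunctorialCylinder E) : Prop where
  /-- the awfs is cofibrantly generated, by a small category of arrows -/
  cofibrantlyGenerated : AWFS.CofibrantlyGenerated.{w} W
  /-- `⊥ : E ⥤ Arrow E` factors through `Cof` -/
  bot : ∃ F : E ⥤ W.Cof, F ⋙ W.cofForget = botFunctor E
  /-- the pullback functor lifts to a functor `Cof ×_E Arrow E ⥤ Cof` -/
  pullback : ∃ F : CospanOver W.cofForget ⥤ W.Cof,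
    F ⋙ W.cofForget = Comma.preRight (𝟭 E) W.cofForget Arrow.rightFunc ⋙ pullbackFunctor E
  /-- the Leibniz product functors `δᵏ ⊗̂ (-)` lift to functors `Cof ⥤ Cof` -/
  leibniz : ∀ k : Fin 2, ∃ F : W.Cof ⥤ W.Cof, F ⋙ W.cofForget = W.cofForget ⋙ Cyl.leibniz k

end UniformFibrations

end

noncomputable section

namespace UniformFibrations

open Opposite

/-! ### Elementwise lemmas for presheaves -/

section Presheaf

variable {C : Type u} [SmallCategory C] {X Y : Cᵒᵖ ⥤ Type u}

/-! A filler against a monomorphism `m : A ⟶ B` in M can be computed one element of `B` at a time.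
Pulling `m` back along an element `b`, seen as a map from a representable, gives the inclusion of
the sieve of those maps along which `b` restricts into `A`, and by (M3) this inclusion lies in M.
Naturality in pullback squares says that the filler at `b` is the filler for this sieve, and that
fillers for sieves are stable under restriction. So a right M-map is a map `f : X ⟶ Y` with an
operation that extends each compatible family of elements of `X`, indexed by a sieve in `sievesOf M`
and lying over some `y`, to an element over `y`, stably under restriction (`SieveAlg`,
`SieveDense.isoOver_rightMap`). Only a small set of sieves is involved, hence cofibrant generation.

The free algebra on `f` is explicit: its elements are trees whose leaves are elements of `X` and
whose nodes carry an element `y`, a non-maximal sieve and a compatible family of smaller trees. Over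
a maximal sieve the extension is forced; excluding such nodes makes trees unique normal forms, so no
quotient is needed. The universal property is `free.lift` and `free.hom_ext`. Algebra structures
compose vertically, which yields the comultiplication, and the awfs laws compare homomorphisms out
of a free algebra that agree on generators.

A coalgebra structure on `i : A ⟶ B` is a section of `free.proj` that restricts to `free.leaf` along
`i`. For `⊥` it comes from extending empty families. For pullbacks, free algebras preserve pullback
squares (`free.map_isPullback`), so sections pull back. For Leibniz products, fillers against the
product of an endpoint with `i` transpose to fillers of the pullback hom against `i`. By (C1), (C2)
and (M4) the Leibniz product keeps M and its pullback squares (`leib_isPullback`), so the pullback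
hom of an algebra is an algebra (`LeibnizStable.pathAlg`). The universal property then maps the free
algebra on `i` to the path object of the free algebra on the Leibniz product; composing with the
section and transposing gives the new section. -/

lemma app_map (f : X ⟶ Y) {c d : C} (g : d ⟶ c) (x : X.obj (op c)) :
    f.app (op d) (X.map g.op x) = Y.map g.op (f.app (op c) x) :=
  NatTrans.naturality_apply f g.op x

lemma map_map (X : Cᵒᵖ ⥤ Type u) {c d e : C} (g : d ⟶ c) (k : e ⟶ d) (x : X.obj (op c)) :
    X.map k.op (X.map g.op x) = X.map (k ≫ g).op x := by
  simp

lemma map_id_op (X : Cᵒᵖ ⥤ Type u) {c : C} (x : X.obj (op c)) : X.map (𝟙 c).op x = x := by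
  simp

end Presheaf

/-! ### Compatible families and algebras -/

/-- A class of sieves that is closed under pullback. -/
structure StableSieves (C : Type u) [SmallCategory C] where
  /-- the sieves of the class -/
  mem : ∀ {c : C}, Sieve c → Prop
  pullback_mem : ∀ {c d : C} (g : d ⟶ c) {S : Sieve c}, mem S → mem (S.pullback g)

variable {C : Type u} [SmallCategory C]

lemma mem_of_pullback {c d e : C} {g : d ⟶ c} {S : Sieve c} {k : e ⟶ d} (h : S.pullback g k) :
    S (k ≫ g) :=
  h

/-- A compatible family of elements of `X`, indexed by the sieve `S`, lying over the restrictions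
of the element `y` of `Y`. -/
structure Family {X Y : Cᵒᵖ ⥤ Type u} (f : X ⟶ Y) {c : C} (S : Sieve c) (y : Y.obj (op c)) where
  /-- the elements of the family -/
  val : ∀ {d : C} (g : d ⟶ c), S g → X.obj (op d)
  map_val : ∀ {d e : C} (g : d ⟶ c) (h : S g) (k : e ⟶ d),
    X.map k.op (val g h) = val (k ≫ g) (S.downward_closed h k)
  app_val : ∀ {d : C} (g : d ⟶ c) (h : S g), f.app (op d) (val g h) = Y.map g.op y

namespace Family

variable {X Y X' Y' X'' Y'' : Cᵒᵖ ⥤ Type u} {f : X ⟶ Y} {f' : X' ⟶ Y'} {c : C} {S : Sieve c}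
  {y : Y.obj (op c)}

@[ext]
lemma ext {s t : Family f S y} (h : ∀ {d : C} (g : d ⟶ c) (hg : S g), s.val g hg = t.val g hg) :
    s = t := by
  obtain ⟨s, _, _⟩ := s
  obtain ⟨t, _, _⟩ := t
  have : @s = @t := by
    funext d g hg
    exact h g hg
  subst this
  rfl

/-- The restriction of a family along a map of the base. -/
@[simps]
def pull (s : Family f S y) {d : C} (g : d ⟶ c) : Family f (S.pullback g) (Y.map g.op y) where
  val k hk := s.val (k ≫ g) (mem_of_pullback hk)
  map_val k hk l := by simp only [s.map_val, Category.assoc]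
  app_val k hk := by rw [s.app_val, map_map]

/-- The image of a family under a commutative square. -/
@[simps]
def push (s : Family f S y) (a : X ⟶ X') (b : Y ⟶ Y') (w : a ≫ f' = f ≫ b) :
    Family f' S (b.app (op c) y) where
  val g hg := a.app _ (s.val g hg)
  map_val g hg k := by rw [← app_map, s.map_val]
  app_val g hg := by
    have := congrArg (fun t => t.app (op _) (s.val g hg)) w
    simp only [NatTrans.comp_app] at this
    refine this.trans ?_
    change b.app _ (f.app _ _) = _
    rw [s.app_val, app_map]

/-- The image in `Y` of a family for a composite `X ⟶ Y ⟶ Z`. -/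
@[simps]
def snd {Z : Cᵒᵖ ⥤ Type u} {g : Y ⟶ Z} {z : Z.obj (op c)} (s : Family (f ≫ g) S z) :
    Family g S z where
  val k hk := f.app _ (s.val k hk)
  map_val k hk l := by rw [← app_map, s.map_val]
  app_val k hk := s.app_val k hk

/-- A family for a composite `X ⟶ Y ⟶ Z`, viewed as a family over an element of `Y` that extends
its image in `Y`. -/
@[simps]
def fst {Z : Cᵒᵖ ⥤ Type u} {g : Y ⟶ Z} {z : Z.obj (op c)} (s : Family (f ≫ g) S z)
    (y : Y.obj (op c)) (h : ∀ {d : C} (k : d ⟶ c) (hk : S k), Y.map k.op y = s.snd.val k hk) :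
    Family f S y where
  val k hk := s.val k hk
  map_val k hk l := s.map_val k hk l
  app_val k hk := (h k hk).symm

/-- Replacing the base element by an equal one. -/
@[simps]
def cast (s : Family f S y) {y' : Y.obj (op c)} (h : y = y') : Family f S y' where
  val g hg := s.val g hg
  map_val g hg k := s.map_val g hg k
  app_val g hg := by rw [s.app_val, h]

end Family

/-- An algebra structure on `f : X ⟶ Y`: a way to extend every compatible family on a sieve in `J`
over an element `y` to an element over `y`, compatibly with restriction. -/
structure SieveAlg (J : StableSieves C) {X Y : Cᵒᵖ ⥤ Type u} (f : X ⟶ Y) where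
  /-- the extension operation -/
  extend : ∀ {c : C} (S : Sieve c) (_ : J.mem S) (y : Y.obj (op c)) (_ : Family f S y), X.obj (op c)
  app_extend : ∀ {c : C} (S : Sieve c) (hS : J.mem S) (y : Y.obj (op c)) (s : Family f S y),
    f.app (op c) (extend S hS y s) = y
  map_extend_of_mem : ∀ {c : C} (S : Sieve c) (hS : J.mem S) (y : Y.obj (op c)) (s : Family f S y)
    {d : C} (g : d ⟶ c) (hg : S g), X.map g.op (extend S hS y s) = s.val g hg
  map_extend : ∀ {c : C} (S : Sieve c) (hS : J.mem S) (y : Y.obj (op c)) (s : Family f S y)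
    {d : C} (g : d ⟶ c),
    X.map g.op (extend S hS y s) = extend (S.pullback g) (J.pullback_mem g hS) (Y.map g.op y) (s.pull g)

namespace SieveAlg

variable {J : StableSieves C} {X Y Z X' Y' Z' X'' Y'' : Cᵒᵖ ⥤ Type u} {f : X ⟶ Y} {f' : X' ⟶ Y'}
  {f'' : X'' ⟶ Y''}

/-- Families over different sieves or base elements have different types. Equalities of extensions
are reduced here to pointwise agreement of the families. -/
lemma extend_congr (α : SieveAlg J f) {c : C} {S S' : Sieve c} {hS : J.mem S} {hS' : J.mem S'}
    {y y' : Y.obj (op c)} {s : Family f S y} {s' : Family f S' y'} (e₁ : S = S') (e₂ : y = y')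
    (e₃ : ∀ {d : C} (g : d ⟶ c) (h : S g) (h' : S' g), s.val g h = s'.val g h') :
    α.extend S hS y s = α.extend S' hS' y' s' := by
  subst e₁ e₂
  congr 1
  ext d g hg
  exact e₃ g hg hg

/-- Over a maximal sieve the extension is forced, since it must restrict along the identity to a
member of the family. This is why free algebras need nodes only for non-maximal sieves. -/
lemma extend_of_mem_id (α : SieveAlg J f) {c : C} {S : Sieve c} (hS : J.mem S)
    (y : Y.obj (op c)) (s : Family f S y) (h : S (𝟙 c)) : α.extend S hS y s = s.val (𝟙 c) h := by
  rw [← α.map_extend_of_mem S hS y s (𝟙 c) h, map_id_op]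

/-- Two algebra structures with the same operation are equal. -/
lemma eq_of_extend {α β : SieveAlg J f}
    (h : ∀ {c : C} (S : Sieve c) (hS : J.mem S) (y : Y.obj (op c)) (s : Family f S y),
      α.extend S hS y s = β.extend S hS y s) : α = β := by
  obtain ⟨a, _, _, _⟩ := α
  obtain ⟨b, _, _, _⟩ := β
  have : @a = @b := by
    funext c S hS y s
    exact h S hS y s
  subst this
  rfl

/-- A square that preserves the extension operations. -/
structure IsHom (α : SieveAlg J f) (β : SieveAlg J f') (a : X ⟶ X') (b : Y ⟶ Y') : Prop where
  w : a ≫ f' = f ≫ b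
  app_extend : ∀ {c : C} (S : Sieve c) (hS : J.mem S) (y : Y.obj (op c)) (s : Family f S y),
    a.app (op c) (α.extend S hS y s) = β.extend S hS (b.app (op c) y) (s.push a b w)

lemma IsHom.id (α : SieveAlg J f) : IsHom α α (𝟙 X) (𝟙 Y) where
  w := by simp
  app_extend S hS y s := α.extend_congr rfl rfl fun g h h' => rfl

lemma IsHom.comp {α : SieveAlg J f} {β : SieveAlg J f'} {γ : SieveAlg J f''}
    {a : X ⟶ X'} {b : Y ⟶ Y'} {a' : X' ⟶ X''} {b' : Y' ⟶ Y''}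
    (h : IsHom α β a b) (h' : IsHom β γ a' b') : IsHom α γ (a ≫ a') (b ≫ b') where
  w := by rw [Category.assoc, h'.w, ← Category.assoc, h.w, Category.assoc]
  app_extend S hS y s := by
    change a'.app _ (a.app _ _) = _
    rw [h.app_extend, h'.app_extend]
    exact γ.extend_congr rfl rfl fun g h h' => rfl

/-- The algebra structure on a composite. -/
def comp {g : Y ⟶ Z} (α : SieveAlg J f) (β : SieveAlg J g) : SieveAlg J (f ≫ g) where
  -- The family is first pushed to `Y` and extended there over `z`; the result serves as the base
  -- element for the extension in `X`.
  extend S hS z s := α.extend S hS (β.extend S hS z s.snd)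
    (s.fst _ fun k hk => β.map_extend_of_mem _ _ _ _ k hk)
  app_extend S hS z s := by
    change g.app _ (f.app _ _) = _
    rw [α.app_extend, β.app_extend]
  map_extend_of_mem S hS z s d k hk := by
    rw [α.map_extend_of_mem _ _ _ _ k hk, Family.fst_val]
  map_extend S hS z s d k := by
    rw [α.map_extend]
    refine α.extend_congr rfl ?_ fun g h h' => rfl
    rw [β.map_extend]
    exact β.extend_congr rfl rfl fun g h h' => rfl

lemma comp_extend {g : Y ⟶ Z} (α : SieveAlg J f) (β : SieveAlg J g) {c : C} (S : Sieve c)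
    (hS : J.mem S) (z : Z.obj (op c)) (s : Family (f ≫ g) S z) :
    (α.comp β).extend S hS z s = α.extend S hS (β.extend S hS z s.snd)
      (s.fst _ fun k hk => β.map_extend_of_mem _ _ _ _ k hk) :=
  rfl

/-- Vertical composition of algebras is functorial in squares. Together with `fst` and `assoc`, this
supplies the homomorphisms behind the comonad laws. -/
lemma IsHom.horizComp {g : Y ⟶ Z} {g' : Y' ⟶ Z'} {α : SieveAlg J f} {β : SieveAlg J g}
    {α' : SieveAlg J f'} {β' : SieveAlg J g'} {a : X ⟶ X'} {b : Y ⟶ Y'} {c : Z ⟶ Z'}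
    (h : IsHom α α' a b) (h' : IsHom β β' b c) : IsHom (α.comp β) (α'.comp β') a c where
  w := by rw [← Category.assoc, h.w, Category.assoc, h'.w, Category.assoc]
  app_extend S hS y s := by
    rw [comp_extend, comp_extend]
    rw [h.app_extend]
    refine α'.extend_congr rfl ?_ fun g h h' => rfl
    rw [h'.app_extend]
    refine β'.extend_congr rfl rfl fun g hg hg' => ?_
    have := congrArg (fun t => t.app (op _) (s.val g hg)) h.w
    exact this.symm

lemma IsHom.fst {g : Y ⟶ Z} (α : SieveAlg J f) (β : SieveAlg J g) :
    IsHom (α.comp β) β f (𝟙 Z) where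
  w := by simp
  app_extend S hS y s := by
    rw [comp_extend, α.app_extend]
    exact β.extend_congr rfl rfl fun g h h' => rfl

lemma IsHom.assoc {W : Cᵒᵖ ⥤ Type u} {g : Y ⟶ Z} {k : Z ⟶ W} (α : SieveAlg J f)
    (β : SieveAlg J g) (γ : SieveAlg J k) :
    IsHom ((α.comp β).comp γ) (α.comp (β.comp γ)) (𝟙 X) (𝟙 W) where
  w := by simp
  app_extend S hS y s :=
    α.extend_congr rfl (β.extend_congr rfl rfl fun g h h' => rfl) fun g h h' => rfl

end SieveAlg

/-! ### The free algebra -/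

/-- Formal iterated extensions: a tree is an element of `X`, or an element of `Y` together with a
family of trees indexed by a sieve. -/
inductive Tree (X Y : Cᵒᵖ ⥤ Type u) : C → Type u
  | leaf {c : C} (x : X.obj (op c)) : Tree X Y c
  | node {c : C} (S : Sieve c) (y : Y.obj (op c)) (s : ∀ (d : C) (g : d ⟶ c), S g → Tree X Y d) :
      Tree X Y c

namespace Tree

variable {X Y X' Y' : Cᵒᵖ ⥤ Type u}

open Classical in
/-- The restriction of a tree. -/
def map {c d : C} (t : Tree X Y c) (g : d ⟶ c) : Tree X Y d :=
  match t with
  | leaf x => leaf (X.map g.op x)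
  | node S y s =>
    -- Along a map in `S` the restriction is already one of the subtrees. Otherwise the node itself
    -- is restricted, and its sieve remains non-maximal because `g` is not in `S`.
    if h : S g then s d g h
    else node (S.pullback g) (Y.map g.op y) fun e k hk => s e (k ≫ g) (mem_of_pullback hk)

/-- The element of the base below a tree. -/
def label (f : X ⟶ Y) {c : C} (t : Tree X Y c) : Y.obj (op c) :=
  match t with
  | leaf x => f.app (op c) x
  | node _ y _ => y

/-- The trees all of whose nodes are labelled by a non-maximal sieve in `J` and a compatible family
of trees. -/
def WF (J : StableSieves C) (f : X ⟶ Y) {c : C} (t : Tree X Y c) : Prop :=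
  match t with
  | leaf _ => True
  | @node _ _ _ _ c S y s => J.mem S ∧ ¬ S (𝟙 c) ∧ ∀ (d : C) (g : d ⟶ c) (h : S g),
      (s d g h).WF J f ∧ (s d g h).label f = Y.map g.op y ∧
        ∀ (e : C) (k : e ⟶ d), (s d g h).map k = s e (k ≫ g) (S.downward_closed h k)

variable {J : StableSieves C} {f : X ⟶ Y}

lemma map_node_of_mem {c : C} {S : Sieve c} {y : Y.obj (op c)}
    {s : ∀ (d : C) (g : d ⟶ c), S g → Tree X Y d} {d : C} {g : d ⟶ c} (h : S g) :
    (node S y s).map g = s d g h := by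
  simp [map, h]

lemma map_node_of_not_mem {c : C} {S : Sieve c} {y : Y.obj (op c)}
    {s : ∀ (d : C) (g : d ⟶ c), S g → Tree X Y d} {d : C} {g : d ⟶ c} (h : ¬ S g) :
    (node S y s).map g =
      node (S.pullback g) (Y.map g.op y) fun e k hk => s e (k ≫ g) (mem_of_pullback hk) := by
  simp [map, h]

lemma WF.map {c d : C} {t : Tree X Y c} (ht : t.WF J f) (g : d ⟶ c) : (t.map g).WF J f := by
  cases t with
  | leaf x => trivial
  | node S y s =>
    obtain ⟨hS, hne, hs⟩ := ht
    by_cases h : S g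
    · rw [map_node_of_mem h]
      exact (hs d g h).1
    · rw [map_node_of_not_mem h]
      refine ⟨J.pullback_mem g hS, by simpa using h, fun e k hk => ⟨(hs _ _ _).1, ?_, ?_⟩⟩
      · simp only [(hs _ _ _).2.1, map_map]
      · intro e' k'
        simp only [(hs _ _ _).2.2, Category.assoc]

lemma label_map {c d : C} {t : Tree X Y c} (ht : t.WF J f) (g : d ⟶ c) :
    (t.map g).label f = Y.map g.op (t.label f) := by
  cases t with
  | leaf x => exact app_map f g x
  | node S y s =>
    obtain ⟨hS, hne, hs⟩ := ht
    by_cases h : S g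
    · rw [map_node_of_mem h]
      exact (hs d g h).2.1
    · rw [map_node_of_not_mem h]
      rfl

lemma node_congr {c : C} {S S' : Sieve c} {y y' : Y.obj (op c)}
    {s : ∀ (d : C) (g : d ⟶ c), S g → Tree X Y d} {s' : ∀ (d : C) (g : d ⟶ c), S' g → Tree X Y d}
    (e₁ : S = S') (e₂ : y = y')
    (e₃ : ∀ (d : C) (g : d ⟶ c) (h : S g) (h' : S' g), s d g h = s' d g h') :
    node S y s = node S' y' s' := by
  subst e₁ e₂
  congr 1
  funext d g h
  exact e₃ d g h h

/-- Well-formedness is essential: a node on a maximal sieve would restrict along the identity to one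
of its own subtrees. -/
lemma map_id {c : C} {t : Tree X Y c} (ht : t.WF J f) : t.map (𝟙 c) = t := by
  cases t with
  | leaf x => exact congrArg leaf (map_id_op X x)
  | node S y s =>
    obtain ⟨hS, hne, hs⟩ := ht
    rw [map_node_of_not_mem hne]
    refine node_congr (Sieve.pullback_id) (map_id_op Y y) fun d g h h' => ?_
    simp only [Category.comp_id]

lemma map_comp {c d e : C} {t : Tree X Y c} (ht : t.WF J f) (g : d ⟶ c) (k : e ⟶ d) :
    (t.map g).map k = t.map (k ≫ g) := by
  cases t with
  | leaf x => exact congrArg leaf (map_map X g k x)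
  | node S y s =>
    obtain ⟨hS, hne, hs⟩ := ht
    by_cases h : S g
    · rw [map_node_of_mem h, map_node_of_mem (S.downward_closed h k), (hs d g h).2.2]
    · rw [map_node_of_not_mem h]
      by_cases h' : S (k ≫ g)
      · rw [map_node_of_mem h', map_node_of_mem (S := S.pullback g) h']
      · rw [map_node_of_not_mem h', map_node_of_not_mem (S := S.pullback g) h']
        refine node_congr (Sieve.pullback_comp _).symm (map_map Y g k y) fun d g h h' => ?_
        simp only [Category.assoc]

open Classical in
/-- The evaluation of a tree in an algebra, defined at least on well-formed trees. -/
def eval {f' : X' ⟶ Y'} (β : SieveAlg J f') (a : X ⟶ X') (b : Y ⟶ Y') {c : C} (t : Tree X Y c) :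
    Option (X'.obj (op c)) :=
  match t with
  | leaf x => some (a.app _ x)
  | @node _ _ _ _ c S y s =>
    -- The recursion runs over raw trees, where the values at the subtrees need not form a
    -- compatible family; this is tested, and the value is optional. A family is determined by its
    -- members, so the choice is harmless.
    if h : ∃ (_ : J.mem S) (s' : Family f' S (b.app (op c) y)),
      ∀ (d : C) (g : d ⟶ c) (hg : S g), (s d g hg).eval β a b = some (s'.val g hg)
    then some (β.extend S h.choose _ h.choose_spec.choose) else none

lemma eval_node {f' : X' ⟶ Y'} (β : SieveAlg J f') (a : X ⟶ X') (b : Y ⟶ Y') {c : C} {S : Sieve c}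
    {y : Y.obj (op c)} {s : ∀ (d : C) (g : d ⟶ c), S g → Tree X Y d} (hS : J.mem S)
    (s' : Family f' S (b.app (op c) y))
    (h : ∀ (d : C) (g : d ⟶ c) (hg : S g), (s d g hg).eval β a b = some (s'.val g hg)) :
    (node S y s).eval β a b = some (β.extend S hS _ s') := by
  have H : ∃ (_ : J.mem S) (s' : Family f' S (b.app (op c) y)),
      ∀ (d : C) (g : d ⟶ c) (hg : S g), (s d g hg).eval β a b = some (s'.val g hg) :=
    ⟨hS, s', h⟩
  rw [eval, dif_pos H]
  congr 2
  ext d g hg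
  exact Option.some_injective _ ((H.choose_spec.choose_spec d g hg).symm.trans (h d g hg))

/-- Definedness alone is not inductive: the values at the subtrees form a family only because they
lie over the labels and evaluation commutes with restriction, so all three are proved together. -/
lemma exists_eval {f' : X' ⟶ Y'} (β : SieveAlg J f') {a : X ⟶ X'} {b : Y ⟶ Y'}
    (w : a ≫ f' = f ≫ b) {c : C} (t : Tree X Y c) (ht : t.WF J f) :
    ∃ x, t.eval β a b = some x ∧ f'.app (op c) x = b.app (op c) (t.label f) ∧
      ∀ (d : C) (g : d ⟶ c), (t.map g).eval β a b = some (X'.map g.op x) := by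
  induction t with
  | leaf x =>
    refine ⟨a.app _ x, rfl, congrArg (fun t => t.app (op _) x) w, fun d g => ?_⟩
    exact congrArg some (app_map a g x)
  | @node c S y s ih =>
    obtain ⟨hS, hne, hs⟩ := ht
    choose v hv₁ hv₂ hv₃ using fun d g h => ih d g h (hs d g h).1
    let s' : Family f' S (b.app (op c) y) :=
      { val := fun {d} g h => v d g h
        map_val := fun {d e} g h k => by
          have := hv₃ d g h e k
          rw [(hs d g h).2.2, hv₁] at this
          exact (Option.some_injective _ this).symm
        app_val := fun {d} g h => by
          rw [hv₂, (hs d g h).2.1, app_map] }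
    refine ⟨β.extend S hS _ s', eval_node β a b hS s' fun d g h => hv₁ d g h, β.app_extend _ _ _ _,
      fun d g => ?_⟩
    by_cases h : S g
    · rw [map_node_of_mem h, hv₁, β.map_extend_of_mem _ _ _ _ g h]
    · rw [map_node_of_not_mem h,
        eval_node β a b (J.pullback_mem g hS) ((s'.pull g).cast (app_map b g y).symm)
        fun e k hk => hv₁ _ _ _, β.map_extend]
      exact congrArg some (β.extend_congr rfl (app_map b g y) fun g h h' => rfl)

end Tree

end UniformFibrations

end

/-! ### The presheaf of well-formed trees and its universal property. -/

noncomputable section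

namespace UniformFibrations

open Opposite

variable {C : Type u} [SmallCategory C]

section Free

variable (J : StableSieves C) {X Y X' Y' : Cᵒᵖ ⥤ Type u} (f : X ⟶ Y)

/-- The free algebra on `f`: the presheaf of well-formed trees. -/
def free : Cᵒᵖ ⥤ Type u where
  obj c := {t : Tree X Y c.unop // t.WF J f}
  map g := TypeCat.ofHom fun t => ⟨t.1.map g.unop, t.2.map g.unop⟩
  map_id c := by
    ext t
    exact Tree.map_id t.2
  map_comp g k := by
    ext t
    exact (Tree.map_comp t.2 g.unop k.unop).symm

namespace free

/-- The inclusion of the generators. -/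
def leaf : X ⟶ free J f where
  app c := TypeCat.ofHom fun x => ⟨Tree.leaf x, trivial⟩

/-- The projection of the free algebra. -/
def proj : free J f ⟶ Y where
  app c := TypeCat.ofHom fun t => t.1.label f
  naturality c d g := by
    ext t
    exact Tree.label_map t.2 g.unop

lemma leaf_proj : leaf J f ≫ proj J f = f := rfl

variable {J f}

/-- The tree with a given root. -/
def node {c : C} (S : Sieve c) (hS : J.mem S) (h : ¬ S (𝟙 c)) (y : Y.obj (op c))
    (s : Family (proj J f) S y) : (free J f).obj (op c) :=
  ⟨Tree.node S y fun _ g hg => (s.val g hg).1, hS, h, fun _ g hg =>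
    ⟨(s.val g hg).2, s.app_val g hg, fun _ k => congrArg Subtype.val (s.map_val g hg k)⟩⟩

lemma map_node_of_mem {c : C} {S : Sieve c} (hS : J.mem S) (h : ¬ S (𝟙 c)) (y : Y.obj (op c))
    (s : Family (proj J f) S y) {d : C} {g : d ⟶ c} (hg : S g) :
    (free J f).map g.op (node S hS h y s) = s.val g hg := by
  apply Subtype.ext
  exact Tree.map_node_of_mem (S := S) (y := y) (s := fun _ g hg => (s.val g hg).1) hg

lemma map_node_of_not_mem {c : C} {S : Sieve c} (hS : J.mem S) (h : ¬ S (𝟙 c)) (y : Y.obj (op c))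
    (s : Family (proj J f) S y) {d : C} {g : d ⟶ c} (hg : ¬ S.pullback g (𝟙 d)) :
    (free J f).map g.op (node S hS h y s) =
      node (S.pullback g) (J.pullback_mem g hS) hg (Y.map g.op y) (s.pull g) := by
  apply Subtype.ext
  exact Tree.map_node_of_not_mem (S := S) (y := y) (s := fun _ g hg => (s.val g hg).1) (by simpa using hg)

variable (J f)

open Classical in
/-- The algebra structure of the free algebra. -/
def alg : SieveAlg J (proj J f) where
  extend {c} S hS y s := if h : S (𝟙 c) then s.val (𝟙 c) h else node S hS h y s
  app_extend {c} S hS y s := by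
    split_ifs with h
    · rw [s.app_val, map_id_op]
    · rfl
  map_extend_of_mem {c} S hS y s d g hg := by
    split_ifs with h
    · rw [s.map_val]
      simp only [Category.comp_id]
    · exact map_node_of_mem hS h y s hg
  map_extend {c} S hS y s d g := by
    by_cases h : S (𝟙 c)
    · have hg : S g := by simpa using S.downward_closed h g
      have h' : S.pullback g (𝟙 d) := by simpa using hg
      rw [dif_pos h, dif_pos h', s.map_val]
      simp only [Family.pull_val, Category.comp_id, Category.id_comp]
    · rw [dif_neg h]
      by_cases h' : S.pullback g (𝟙 d)
      · have hg : S g := by simpa using h'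
        rw [dif_pos h']
        refine (map_node_of_mem hS h y s hg).trans ?_
        simp only [Family.pull_val, Category.id_comp]
      · rw [dif_neg h']
        exact map_node_of_not_mem hS h y s h'

variable {J f}

lemma alg_extend_of_not_mem {c : C} {S : Sieve c} (hS : J.mem S) (h : ¬ S (𝟙 c))
    (y : Y.obj (op c)) (s : Family (proj J f) S y) : (alg J f).extend S hS y s = node S hS h y s :=
  dif_neg h

/-- Every element of the free algebra is a generator or a proper extension. -/
@[elab_as_elim]
lemma induction {P : ∀ {c : C}, (free J f).obj (op c) → Prop}
    (h₁ : ∀ {c : C} (x : X.obj (op c)), P ((leaf J f).app (op c) x))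
    (h₂ : ∀ {c : C} (S : Sieve c) (hS : J.mem S) (h : ¬ S (𝟙 c)) (y : Y.obj (op c))
      (s : Family (proj J f) S y), (∀ {d : C} (g : d ⟶ c) (hg : S g), P (s.val g hg)) →
        P (node S hS h y s)) {c : C} (t : (free J f).obj (op c)) : P t := by
  obtain ⟨t, ht⟩ := t
  change Tree X Y c at t
  induction t with
  | leaf x => exact h₁ x
  | @node c S y s ih =>
    have ht' := ht
    obtain ⟨hS, h, hs⟩ := ht'
    exact h₂ S hS h y
      { val := fun {d} g hg => ⟨s d g hg, (hs d g hg).1⟩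
        map_val := fun {d e} g hg k => Subtype.ext ((hs d g hg).2.2 e k)
        app_val := fun {d} g hg => (hs d g hg).2.1 }
      fun {d} g hg => ih d g hg (hs d g hg).1

/-- The extension of a square to the free algebra. -/
def lift {f' : X' ⟶ Y'} (β : SieveAlg J f') (a : X ⟶ X') (b : Y ⟶ Y') (w : a ≫ f' = f ≫ b) :
    free J f ⟶ X' where
  app c := TypeCat.ofHom fun t => (t.1.exists_eval β w t.2).choose
  naturality c d g := by
    ext t
    refine Option.some_injective _ ?_
    exact ((t.1.map g.unop).exists_eval β w (t.2.map _)).choose_spec.1.symm.trans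
      ((t.1.exists_eval β w t.2).choose_spec.2.2 d.unop g.unop)

lemma lift_app {f' : X' ⟶ Y'} (β : SieveAlg J f') (a : X ⟶ X') (b : Y ⟶ Y')
    (w : a ≫ f' = f ≫ b) {c : C} (t : (free J f).obj (op c)) :
    t.1.eval β a b = some ((lift β a b w).app (op c) t) :=
  (t.1.exists_eval β w t.2).choose_spec.1

lemma leaf_lift {f' : X' ⟶ Y'} (β : SieveAlg J f') (a : X ⟶ X') (b : Y ⟶ Y')
    (w : a ≫ f' = f ≫ b) : leaf J f ≫ lift β a b w = a := by
  ext c x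
  exact Option.some_injective _ (lift_app β a b w ((leaf J f).app c x)).symm

lemma lift_isHom {f' : X' ⟶ Y'} (β : SieveAlg J f') (a : X ⟶ X') (b : Y ⟶ Y')
    (w : a ≫ f' = f ≫ b) : (alg J f).IsHom β (lift β a b w) b where
  w := by
    ext c t
    exact (t.1.exists_eval β w t.2).choose_spec.2.1
  app_extend {c} S hS y s := by
    by_cases h : S (𝟙 c)
    · rw [SieveAlg.extend_of_mem_id _ _ _ _ h, SieveAlg.extend_of_mem_id _ _ _ _ h, Family.push_val]
    · rw [alg_extend_of_not_mem hS h]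
      refine Option.some_injective _ ((lift_app β a b w _).symm.trans ?_)
      exact Tree.eval_node β a b hS _ fun d g hg => lift_app β a b w _

/-- By induction on trees: a homomorphism is determined at a node by its values on the subtrees. To
prove an identity of the awfs it is enough to exhibit both sides as homomorphisms over the same base
map and compare them on generators. -/
lemma hom_ext {f' : X' ⟶ Y'} {β : SieveAlg J f'} {k k' : free J f ⟶ X'} {b : Y ⟶ Y'}
    (h : (alg J f).IsHom β k b) (h' : (alg J f).IsHom β k' b)
    (e : leaf J f ≫ k = leaf J f ≫ k') : k = k' := by
  have key : ∀ {c : C} (t : (free J f).obj (op c)), k.app (op c) t = k'.app (op c) t := by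
    intro c t
    induction t using induction with
    | h₁ x => exact congrArg (fun k => k.app (op _) x) e
    | h₂ S hS hne y s ih =>
      rw [← alg_extend_of_not_mem, h.app_extend, h'.app_extend]
      exact β.extend_congr rfl rfl fun g hg _ => ih g hg
  ext c t
  exact key t

end free

end Free

end UniformFibrations

end

noncomputable section

namespace UniformFibrations

open Opposite

variable {C : Type u} [SmallCategory C]

/-! ### The algebraic weak factorization system of a stable class of sieves -/

namespace free

variable {J : StableSieves C} {X Y X' Y' X'' Y'' : Cᵒᵖ ⥤ Type u} {f : X ⟶ Y} {f' : X' ⟶ Y'}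
  {f'' : X'' ⟶ Y''}

variable (J) in
/-- The functoriality of the free algebra. -/
def map (a : X ⟶ X') (b : Y ⟶ Y') (w : a ≫ f' = f ≫ b) : free J f ⟶ free J f' :=
  lift (alg J f') (a ≫ leaf J f') b (by rw [Category.assoc, leaf_proj, w])

lemma leaf_map (a : X ⟶ X') (b : Y ⟶ Y') (w : a ≫ f' = f ≫ b) :
    leaf J f ≫ map J a b w = a ≫ leaf J f' :=
  leaf_lift _ _ _ _

lemma leaf_map_assoc (a : X ⟶ X') (b : Y ⟶ Y') (w : a ≫ f' = f ≫ b) {Z : Cᵒᵖ ⥤ Type u}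
    (k : free J f' ⟶ Z) : leaf J f ≫ map J a b w ≫ k = a ≫ leaf J f' ≫ k := by
  rw [← Category.assoc, leaf_map, Category.assoc]

lemma map_isHom (a : X ⟶ X') (b : Y ⟶ Y') (w : a ≫ f' = f ≫ b) :
    (alg J f).IsHom (alg J f') (map J a b w) b :=
  lift_isHom _ _ _ _

lemma map_id : map J (𝟙 X) (𝟙 Y) (f := f) (f' := f) (by simp) = 𝟙 (free J f) :=
  hom_ext (map_isHom _ _ _) (SieveAlg.IsHom.id _) (by rw [leaf_map]; simp)

lemma map_comp (a : X ⟶ X') (b : Y ⟶ Y') (w : a ≫ f' = f ≫ b) (a' : X' ⟶ X'') (b' : Y' ⟶ Y'')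
    (w' : a' ≫ f'' = f' ≫ b') (w'' : (a ≫ a') ≫ f'' = f ≫ b ≫ b') :
    map J (a ≫ a') (b ≫ b') w'' = map J a b w ≫ map J a' b' w' :=
  hom_ext (map_isHom _ _ _) ((map_isHom _ _ _).comp (map_isHom _ _ _))
    (by rw [leaf_map, leaf_map_assoc, leaf_map, Category.assoc])

variable (J f) in
/-- The multiplication of the free algebra monad. -/
def mul : free J (proj J f) ⟶ free J f :=
  lift (alg J f) (𝟙 _) (𝟙 Y) (by simp)

lemma leaf_mul : leaf J (proj J f) ≫ mul J f = 𝟙 _ :=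
  leaf_lift _ _ _ _

lemma leaf_mul_assoc {Z : Cᵒᵖ ⥤ Type u} (k : free J f ⟶ Z) :
    leaf J (proj J f) ≫ mul J f ≫ k = k := by
  rw [← Category.assoc, leaf_mul, Category.id_comp]

lemma mul_isHom : (alg J (proj J f)).IsHom (alg J f) (mul J f) (𝟙 Y) :=
  lift_isHom _ _ _ _

variable (J f) in
/-- The comultiplication of the cofree coalgebra comonad. -/
def comul : free J f ⟶ free J (leaf J f) :=
  lift ((alg J (leaf J f)).comp (alg J f)) (leaf J (leaf J f)) (𝟙 Y)
    (by rw [← Category.assoc, leaf_proj, leaf_proj, Category.comp_id])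

lemma leaf_comul : leaf J f ≫ comul J f = leaf J (leaf J f) :=
  leaf_lift _ _ _ _

lemma leaf_comul_assoc {Z : Cᵒᵖ ⥤ Type u} (k : free J (leaf J f) ⟶ Z) :
    leaf J f ≫ comul J f ≫ k = leaf J (leaf J f) ≫ k := by
  rw [← Category.assoc, leaf_comul]

lemma comul_isHom :
    (alg J f).IsHom ((alg J (leaf J f)).comp (alg J f)) (comul J f) (𝟙 Y) :=
  lift_isHom _ _ _ _

lemma comul_proj : comul J f ≫ proj J (leaf J f) = 𝟙 _ := by
  refine hom_ext (β := alg J f) (b := 𝟙 Y) ?_ (SieveAlg.IsHom.id _) ?_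
  · simpa using comul_isHom.comp (SieveAlg.IsHom.fst _ _)
  · rw [← Category.assoc, leaf_comul, leaf_proj, Category.comp_id]

lemma map_comul (a : X ⟶ X') (b : Y ⟶ Y') (w : a ≫ f' = f ≫ b) :
    map J a b w ≫ comul J f' = comul J f ≫ map J a (map J a b w) (leaf_map a b w).symm := by
  refine hom_ext (β := (alg J (leaf J f')).comp (alg J f')) (b := b) ?_ ?_ ?_
  · simpa using (map_isHom a b w).comp comul_isHom
  · simpa using comul_isHom.comp ((map_isHom a _ (leaf_map a b w).symm).horizComp
      (map_isHom a b w))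
  · rw [leaf_map_assoc, leaf_comul, leaf_comul_assoc, leaf_map]

lemma map_mul (a : X ⟶ X') (b : Y ⟶ Y') (w : a ≫ f' = f ≫ b) :
    map J (map J a b w) b (map_isHom a b w).w ≫ mul J f' = mul J f ≫ map J a b w := by
  refine hom_ext (β := alg J f') (b := b) ?_ ?_ ?_
  · simpa using (map_isHom _ _ _).comp mul_isHom
  · simpa using mul_isHom.comp (map_isHom a b w)
  · simp only [leaf_map_assoc, leaf_mul, leaf_mul_assoc, Category.comp_id]

lemma leaf_map_mul : map J (leaf J f) (𝟙 Y) (f' := proj J f)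
    (by rw [leaf_proj, Category.comp_id]) ≫ mul J f = 𝟙 _ := by
  refine hom_ext (β := alg J f) (b := 𝟙 Y) ?_ (SieveAlg.IsHom.id _) ?_
  · simpa using (map_isHom _ _ _).comp mul_isHom
  · rw [← Category.assoc, leaf_map, Category.assoc, leaf_mul]

lemma mul_assoc : map J (mul J f) (𝟙 Y) mul_isHom.w ≫ mul J f = mul J (proj J f) ≫ mul J f := by
  refine hom_ext (β := alg J f) (b := 𝟙 Y) ?_ ?_ ?_
  · simpa using (map_isHom _ _ _).comp mul_isHom
  · simpa using mul_isHom.comp mul_isHom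
  · simp only [leaf_map_assoc, leaf_mul, leaf_mul_assoc, Category.comp_id]

lemma comul_map_proj : comul J f ≫ map J (𝟙 X) (proj J f) (f := leaf J f) (f' := f)
    (by rw [leaf_proj, Category.id_comp]) = 𝟙 _ := by
  refine hom_ext (β := alg J f) (b := 𝟙 Y) ?_ (SieveAlg.IsHom.id _) ?_
  · refine ⟨?_, fun {c} S hS y s => ?_⟩
    · rw [Category.assoc, (map_isHom _ _ _).w, ← Category.assoc, comul_proj, Category.comp_id,
        Category.id_comp]
    · change (map J (𝟙 X) (proj J f) (f := leaf J f) (f' := f)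
        (by rw [leaf_proj, Category.id_comp])).app _ ((comul J f).app _ _) = _
      -- `comul` turns an extension over `y` into one whose base element is itself an extension in
      -- the free algebra on `f`. Mapping along `proj` sends that base element back to `y`.
      rw [comul_isHom.app_extend, SieveAlg.comp_extend, (map_isHom _ _ _).app_extend]
      exact (alg J f).extend_congr rfl ((alg J f).app_extend _ _ _ _) fun g h h' => rfl
  · rw [← Category.assoc, leaf_comul, leaf_map]
    simp

lemma comul_coassoc : comul J f ≫ map J (𝟙 X) (comul J f) (f := leaf J f)
    (f' := leaf J (leaf J f)) (by rw [leaf_comul, Category.id_comp]) =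
      comul J f ≫ comul J (leaf J f) := by
  refine hom_ext (β := (alg J (leaf J (leaf J f))).comp ((alg J (leaf J f)).comp (alg J f)))
    (b := 𝟙 Y) ?_ ?_ ?_
  · simpa using comul_isHom.comp ((map_isHom (J := J) (𝟙 X) (comul J f) _).horizComp comul_isHom)
  · simpa using ((comul_isHom (J := J) (f := f)).comp ((comul_isHom (J := J)
      (f := leaf J f)).horizComp (SieveAlg.IsHom.id (alg J f)))).comp (SieveAlg.IsHom.assoc _ _ _)
  · rw [leaf_comul_assoc, leaf_comul_assoc, leaf_map, leaf_comul, Category.id_comp]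

/-- The nontrivial component of the distributive law, used both for its compatibility with the
multiplication and for that with the comultiplication. Both sides are homomorphisms from the free
algebra on `proj J f` to the composite algebra. -/
lemma mul_comul : mul J f ≫ comul J f =
    comul J (proj J f) ≫ map J (comul J f) (mul J f) (f := leaf J (proj J f))
      (f' := proj J (leaf J f)) (by rw [comul_proj, leaf_mul]) ≫ mul J (leaf J f) := by
  refine hom_ext (β := (alg J (leaf J f)).comp (alg J f)) (b := 𝟙 Y) ?_ ?_ ?_
  · simpa using mul_isHom.comp (comul_isHom (J := J) (f := f))
  · have := (map_isHom (J := J) (comul J f) (mul J f) (f := leaf J (proj J f))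
      (f' := proj J (leaf J f)) (by rw [comul_proj, leaf_mul])).comp mul_isHom
    rw [Category.comp_id] at this
    simpa using (comul_isHom (J := J) (f := proj J f)).comp (this.horizComp mul_isHom)
  · rw [leaf_mul_assoc, leaf_comul_assoc, leaf_map_assoc, leaf_mul, Category.comp_id]

end free

namespace StableSieves

open free

variable (J : StableSieves C)

/-- The functorial factorization through free algebras. -/
def fact : FunctorialFactorization (Cᵒᵖ ⥤ Type u) where
  Z :=
    { obj := fun f => free J f.hom
      map := fun sq => map J sq.left sq.right (Arrow.w sq)
      map_id := fun f => map_id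
      map_comp := fun φ ψ => map_comp _ _ _ _ _ _ _ }
  i :=
    { app := fun f => leaf J f.hom
      naturality := fun f g sq => (leaf_map sq.left sq.right (Arrow.w sq)).symm }
  p :=
    { app := fun f => proj J f.hom
      naturality := fun f g sq => (map_isHom sq.left sq.right (Arrow.w sq)).w }
  fac := by
    ext f : 2
    exact leaf_proj J f.hom
  hi _ := trivial
  hp _ := trivial

/-- The factorization through free algebras, with its comonad and monad structure. -/
def preAWFS : PreAWFS (Cᵒᵖ ⥤ Type u) where
  fact := J.fact
  comul :=
    { app := fun f => Arrow.homMk (f := J.fact.L.obj f) (g := J.fact.L.obj (J.fact.L.obj f))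
        (u := 𝟙 f.left) (v := comul J f.hom) ((Category.id_comp _).trans leaf_comul.symm)
      naturality := fun f g sq => by
        ext1
        · exact (Category.comp_id _).trans (Category.id_comp _).symm
        · exact map_comul sq.left sq.right (Arrow.w sq) }
  mul :=
    { app := fun f => Arrow.homMk (f := J.fact.R.obj (J.fact.R.obj f)) (g := J.fact.R.obj f)
        (u := mul J f.hom) (v := 𝟙 f.right) mul_isHom.w
      naturality := fun f g sq => by
        ext1
        · exact map_mul sq.left sq.right (Arrow.w sq)
        · exact (Category.comp_id _).trans (Category.id_comp _).symm }
  coassoc f := by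
    ext1
    · rfl
    · exact comul_coassoc
  left_counit f := by
    ext1
    · exact Category.id_comp _
    · exact comul_proj
  right_counit f := by
    ext1
    · exact Category.id_comp _
    · exact comul_map_proj
  assoc f := by
    ext1
    · exact mul_assoc
    · rfl
  left_unit f := by
    ext1
    · exact leaf_mul
    · exact Category.id_comp (𝟙 f.right)
  right_unit f := by
    ext1
    · exact leaf_map_mul
    · exact Category.id_comp _

/-- The algebraic weak factorization system of a stable class of sieves. -/
def awfs : AWFS (Cᵒᵖ ⥤ Type u) where
  toPreAWFS := J.preAWFS
  distrib :=
    { unit := fun f => by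
        ext1
        · exact leaf_comul
        · exact leaf_map_mul
      counit := fun f => by
        ext1
        · exact comul_map_proj
        · exact mul_isHom.w.trans (Category.comp_id (proj J (proj J f.hom)))
      mul := fun f => by
        ext1
        · exact mul_comul
        · refine free.mul_assoc.trans ?_
          exact congrArg (mul J _ ≫ ·) (Category.comp_id (mul J f.hom)).symm
      comul := fun f => by
        ext1
        · refine comul_coassoc.trans ?_
          exact (Category.id_comp (comul J f.hom ≫ comul J (leaf J f.hom))).symm
        · exact mul_comul }

end StableSieves

end UniformFibrations

end

noncomputable section

namespace UniformFibrations

open Opposite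

/-! ### Sieves of elements and lifts of squares -/

section Squares

variable {C : Type u} [SmallCategory C] {A B A' B' X Y X' Y' : Cᵒᵖ ⥤ Type u}

lemma isPullback_iff_elementwise {t : A ⟶ X} {l : A ⟶ B} {r : X ⟶ Y} {b : B ⟶ Y} :
    IsPullback t l r b ↔ t ≫ r = l ≫ b ∧ ∀ c : C,
      (∀ x y : A.obj (op c), t.app _ x = t.app _ y → l.app _ x = l.app _ y → x = y) ∧
      ∀ (x : X.obj (op c)) (y : B.obj (op c)), r.app _ x = b.app _ y →
        ∃ z, t.app _ z = x ∧ l.app _ z = y := by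
  rw [IsPullback.iff_app]
  simp only [Types.isPullback_iff]
  constructor
  · intro h
    refine ⟨?_, fun c => ⟨fun x y h₁ h₂ => (h (op c)).2.1 x y ⟨h₁, h₂⟩, (h (op c)).2.2⟩⟩
    ext c : 2
    exact (h c).1
  · rintro ⟨w, h⟩ c
    exact ⟨congrArg (fun t => t.app c) w, fun x y ⟨h₁, h₂⟩ => (h c.unop).1 x y h₁ h₂,
      (h c.unop).2⟩

lemma app_injective (m : A ⟶ B) [Mono m] (c : C) : Function.Injective (m.app (op c)) :=
  (mono_iff_injective _).1 inferInstance

/-- The sieve of those maps along which an element of `B` restricts to an element of the image of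
`m : A ⟶ B`. -/
def sieveOf (m : A ⟶ B) {c : C} (b : B.obj (op c)) : Sieve c where
  arrows d g := ∃ a : A.obj (op d), m.app (op d) a = B.map g.op b
  downward_closed := by
    rintro d e g ⟨a, ha⟩ k
    exact ⟨A.map k.op a, by rw [app_map, ha, map_map]⟩

lemma sieveOf_iff (m : A ⟶ B) {c d : C} (b : B.obj (op c)) (g : d ⟶ c) :
    sieveOf m b g ↔ ∃ a : A.obj (op d), m.app (op d) a = B.map g.op b :=
  Iff.rfl

lemma sieveOf_pullback (m : A ⟶ B) {c d : C} (b : B.obj (op c)) (g : d ⟶ c) :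
    (sieveOf m b).pullback g = sieveOf m (B.map g.op b) := by
  ext e k
  rw [Sieve.pullback_apply, sieveOf_iff, sieveOf_iff, map_map]

lemma sieveOf_functorInclusion {c d : C} (S : Sieve c) (g : d ⟶ c) :
    sieveOf S.functorInclusion (c := d) g = S.pullback g := by
  ext e k
  constructor
  · rintro ⟨⟨a, ha⟩, h⟩
    change a = k ≫ g at h
    subst h
    exact ha
  · intro h
    exact ⟨⟨k ≫ g, h⟩, rfl⟩

lemma sieveOf_functorInclusion_id {c : C} (S : Sieve c) :
    sieveOf S.functorInclusion (𝟙 c) = S := by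
  rw [sieveOf_functorInclusion, Sieve.pullback_id]

/-- In a pullback square, the elements over a restriction of `b` correspond to those over its image
under `q`. This is what makes elementwise fillers natural in pullback squares. -/
lemma sieveOf_of_isPullback {p : A' ⟶ A} {m' : A' ⟶ B'} {m : A ⟶ B} {q : B' ⟶ B}
    (h : IsPullback p m' m q) {c : C} (b : B'.obj (op c)) :
    sieveOf m (q.app (op c) b) = sieveOf m' b := by
  ext d g
  rw [isPullback_iff_elementwise] at h
  constructor
  · rintro ⟨a, ha⟩
    obtain ⟨z, -, hz⟩ := (h.2 d).2 a (B'.map g.op b) (by rw [ha, app_map])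
    exact ⟨z, hz⟩
  · rintro ⟨a, ha⟩
    refine ⟨p.app _ a, ?_⟩
    rw [← app_map, ← ha]
    exact congrArg (fun t => t.app (op d) a) h.1

/-- The preimage under a mono of the restriction of an element along a map of its sieve. -/
def preim (m : A ⟶ B) {c : C} (b : B.obj (op c)) {d : C} (g : d ⟶ c) (hg : sieveOf m b g) :
    A.obj (op d) :=
  Exists.choose hg

lemma app_preim (m : A ⟶ B) {c : C} (b : B.obj (op c)) {d : C} (g : d ⟶ c)
    (hg : sieveOf m b g) : m.app (op d) (preim m b g hg) = B.map g.op b :=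
  Exists.choose_spec hg

lemma preim_eq (m : A ⟶ B) [Mono m] {c : C} (b : B.obj (op c)) {d : C} (g : d ⟶ c)
    (hg : sieveOf m b g) {a : A.obj (op d)} (h : m.app (op d) a = B.map g.op b) :
    preim m b g hg = a :=
  app_injective m d ((app_preim m b g hg).trans h.symm)

lemma map_preim (m : A ⟶ B) [Mono m] {c : C} (b : B.obj (op c)) {d e : C} (g : d ⟶ c)
    (hg : sieveOf m b g) (k : e ⟶ d) : A.map k.op (preim m b g hg) =
      preim m b (k ≫ g) ((sieveOf m b).downward_closed hg k) :=
  (preim_eq m b _ _ (by rw [app_map, app_preim, map_map])).symm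

/-- The projection from the sieve of an element to the domain of the mono. -/
def sieveOfFst (m : A ⟶ B) [Mono m] {c : C} (b : B.obj (op c)) : (sieveOf m b).functor ⟶ A where
  app d := TypeCat.ofHom fun g => preim m b g.1 g.2
  naturality d e k := by
    ext g
    exact (map_preim m b g.1 g.2 k.unop).symm

/-- The bridge from monomorphisms to sieves: a pullback-stable class containing `m` contains the
inclusions of the sieves of all elements of `B`. -/
lemma isPullback_sieveOf (m : A ⟶ B) [Mono m] {c : C} (b : B.obj (op c)) :
    IsPullback (sieveOfFst m b) (sieveOf m b).functorInclusion m (yonedaEquiv.symm b) := by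
  rw [isPullback_iff_elementwise]
  refine ⟨?_, fun d => ⟨fun x y _ h => Subtype.ext h, fun x y h => ?_⟩⟩
  · ext d g
    exact app_preim m b g.1 g.2
  · exact ⟨⟨y, x, h⟩, preim_eq m b y ⟨x, h⟩ h, rfl⟩

/-- The family determined by a square from a mono and an element of its codomain. -/
@[simps]
def Family.ofSquare {f : X ⟶ Y} (m : A ⟶ B) [Mono m] (s : A ⟶ X) (t : B ⟶ Y) (w : s ≫ f = m ≫ t)
    {c : C} (b : B.obj (op c)) : Family f (sieveOf m b) (t.app (op c) b) where
  val g hg := s.app _ (preim m b g hg)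
  map_val {d e} g hg k := by rw [← app_map, map_preim]
  app_val {d} g hg := by
    have := congrArg (fun k => k.app (op d) (preim m b g hg)) w
    refine this.trans ?_
    change t.app _ (m.app _ _) = _
    rw [app_preim, app_map]

end Squares

/-! ### Fillers against monomorphisms built from extension operations. -/

namespace SieveAlg

variable {C : Type u} [SmallCategory C] {J : StableSieves C}
  {A B A' B' X Y X' Y' : Cᵒᵖ ⥤ Type u} {f : X ⟶ Y} {f' : X' ⟶ Y'}

/-- The diagonal of a square from a mono to an algebra. -/
def diag (α : SieveAlg J f) (m : A ⟶ B) [Mono m]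
    (hm : ∀ {c : C} (b : B.obj (op c)), J.mem (sieveOf m b)) (s : A ⟶ X) (t : B ⟶ Y)
    (w : s ≫ f = m ≫ t) : B ⟶ X where
  app c := TypeCat.ofHom fun b =>
    α.extend (sieveOf m (c := c.unop) b) (hm b) _ (Family.ofSquare m s t w b)
  naturality c d g := by
    ext b
    refine Eq.trans ?_ (α.map_extend (sieveOf m (c := c.unop) b) (hm b) _
      (Family.ofSquare m s t w b) g.unop).symm
    refine α.extend_congr (sieveOf_pullback m (c := c.unop) b g.unop).symm (app_map t g.unop b) ?_
    intro e k h h'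
    refine congrArg (s.app _) (preim_eq m _ k h ?_)
    exact (app_preim m (c := c.unop) b (k ≫ g.unop) h').trans (map_map B g.unop k b).symm

variable (α : SieveAlg J f) (m : A ⟶ B) [Mono m]
  (hm : ∀ {c : C} (b : B.obj (op c)), J.mem (sieveOf m b)) (s : A ⟶ X) (t : B ⟶ Y)
  (w : s ≫ f = m ≫ t)

lemma diag_app {c : C} (b : B.obj (op c)) : (α.diag m hm s t w).app (op c) b =
    α.extend (sieveOf m b) (hm b) _ (Family.ofSquare m s t w b) :=
  rfl

lemma comp_diag : m ≫ α.diag m hm s t w = s := by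
  have key : ∀ {c : C} (a : A.obj (op c)),
      (α.diag m hm s t w).app (op c) (m.app (op c) a) = s.app (op c) a := fun {c} a => by
    rw [diag_app, extend_of_mem_id _ _ _ _ ((sieveOf_iff _ _ _).2 ⟨a, (map_id_op B _).symm⟩),
      Family.ofSquare_val]
    exact congrArg (s.app _) (preim_eq m _ _ _ (map_id_op B _).symm)
  ext c a
  exact key a

lemma diag_comp : α.diag m hm s t w ≫ f = t := by
  ext c b
  exact α.app_extend _ _ _ _

lemma diag_of_isPullback (m' : A' ⟶ B') [Mono m']
    (hm' : ∀ {c : C} (b : B'.obj (op c)), J.mem (sieveOf m' b)) {p : A' ⟶ A} {q : B' ⟶ B}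
    (h : IsPullback p m' m q) (w' : (p ≫ s) ≫ f = m' ≫ q ≫ t) :
    q ≫ α.diag m hm s t w = α.diag m' hm' (p ≫ s) (q ≫ t) w' := by
  ext c b
  refine α.extend_congr (sieveOf_of_isPullback (c := c.unop) h b) rfl fun {d} g h₁ h₂ => ?_
  refine congrArg (s.app _) (preim_eq m _ g h₁ ?_)
  refine (congrArg (fun k => k.app (op d) (preim m' (c := c.unop) b g h₂)) h.w).trans ?_
  change q.app _ (m'.app _ _) = _
  rw [app_preim, app_map]
  rfl

lemma IsHom.diag_comp {α : SieveAlg J f} {β : SieveAlg J f'} {k : X ⟶ X'} {l : Y ⟶ Y'}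
    (h : IsHom α β k l) (w' : (s ≫ k) ≫ f' = m ≫ t ≫ l) :
    α.diag m hm s t w ≫ k = β.diag m hm (s ≫ k) (t ≫ l) w' := by
  ext c b
  refine (h.app_extend _ _ _ _).trans ?_
  exact β.extend_congr rfl rfl fun g h₁ h₂ => rfl

/-- The identity of `c`, as an element of the representable, has `S` itself as its sieve, so the
filler against the inclusion of `S` recovers the extension operation. -/
lemma diag_functorInclusion {c : C} {S : Sieve c} (hS : J.mem S)
    (hm : ∀ {d : C} (b : (yoneda.obj c).obj (op d)), J.mem (sieveOf S.functorInclusion b))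
    (s : S.functor ⟶ X) (t : yoneda.obj c ⟶ Y) (w : s ≫ f = S.functorInclusion ≫ t)
    (σ : Family f S (yonedaEquiv t))
    (hσ : ∀ {d : C} (g : d ⟶ c) (hg : S g), s.app (op d) ⟨g, hg⟩ = σ.val g hg) :
    yonedaEquiv (α.diag S.functorInclusion hm s t w) = α.extend S hS (yonedaEquiv t) σ := by
  refine α.extend_congr (sieveOf_functorInclusion_id S) rfl fun {d} g h₁ h₂ => ?_
  rw [← hσ]
  exact congrArg (s.app _) (preim_eq S.functorInclusion _ g h₁ (Category.comp_id g).symm)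

end SieveAlg

end UniformFibrations

end

noncomputable section

namespace UniformFibrations

open Opposite

/-! ### Isomorphisms of categories over a base -/

section IsoOver

variable {B : Type u} [Category.{v} B] {J : Type u₁} [Category.{v₁} J] {K : Type u₂}
  [Category.{v₂} K]

lemma functor_eq_of_faithful (V : K ⥤ B) [V.Faithful] {P Q : J ⥤ K} (hobj : ∀ j, P.obj j = Q.obj j)
    (h : P ⋙ V = Q ⋙ V) : P = Q :=
  CategoryTheory.Functor.ext hobj fun j k f => V.map_injective <| by
    simpa [eqToHom_map] using Functor.congr_hom h f

/-- Morphisms upstairs are determined by their images in `B`, so two functors over `B` that are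
inverse on objects are inverse functors. -/
lemma IsoOver.of_obj {U : J ⥤ B} {V : K ⥤ B} [U.Faithful] [V.Faithful] (F : J ⥤ K) (G : K ⥤ J)
    (hF : F ⋙ V = U) (hG : G ⋙ U = V) (h₁ : ∀ j, G.obj (F.obj j) = j)
    (h₂ : ∀ k, F.obj (G.obj k) = k) : IsoOver U V :=
  ⟨F, G, functor_eq_of_faithful U h₁ (by rw [Functor.assoc, hG, hF, Functor.id_comp]),
    functor_eq_of_faithful V h₂ (by rw [Functor.assoc, hF, hG, Functor.id_comp]), hF⟩

lemma IsoOver.trans {L : Type*} [Category* L] {U : J ⥤ B} {V : K ⥤ B} {W : L ⥤ B} (h : IsoOver U V) (h' : IsoOver V W) :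
    IsoOver U W := by
  obtain ⟨F, G, hFG, hGF, hF⟩ := h
  obtain ⟨F', G', hFG', hGF', hF'⟩ := h'
  refine ⟨F ⋙ F', G' ⋙ G, ?_, ?_, ?_⟩
  · rw [Functor.assoc, ← Functor.assoc F' G' G, hFG', Functor.id_comp, hFG]
  · rw [Functor.assoc, ← Functor.assoc G F F', hGF, Functor.id_comp, hGF']
  · rw [Functor.assoc, hF', hF]

instance {I : Type u₁} [Category.{v₁} I] (u : I ⥤ Arrow B) : (RightMap.forget u).Faithful where
  map_injective h := RightMap.Hom.ext h

end IsoOver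

/-! ### The category of algebras of a stable class of sieves -/

section SieveAlgCat

variable {C : Type u} [SmallCategory C]

/-- An arrow with an algebra structure. -/
structure SieveAlgCat (J : StableSieves C) where
  /-- the underlying arrow -/
  arrow : Arrow (Cᵒᵖ ⥤ Type u)
  /-- the algebra structure -/
  alg : SieveAlg J arrow.hom

namespace SieveAlgCat

variable {J : StableSieves C}

/-- A square that preserves the extension operations. -/
@[ext]
structure Hom (f g : SieveAlgCat J) where
  /-- the underlying square -/
  sq : f.arrow ⟶ g.arrow
  isHom : f.alg.IsHom g.alg sq.left sq.right

instance : Category (SieveAlgCat J) where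
  Hom := Hom
  id f := ⟨𝟙 f.arrow, SieveAlg.IsHom.id _⟩
  comp α β := ⟨α.sq ≫ β.sq, α.isHom.comp β.isHom⟩

variable (J) in
/-- The functor that forgets the algebra structure. -/
def forget : SieveAlgCat J ⥤ Arrow (Cᵒᵖ ⥤ Type u) where
  obj f := f.arrow
  map α := Hom.sq α

instance : (forget J).Faithful where
  map_injective h := Hom.ext h

end SieveAlgCat

/-! ### Algebras for the monad -/

/-- The image of a family under a map over the base. -/
@[simps]
def Family.over {X Y X' : Cᵒᵖ ⥤ Type u} {f : X ⟶ Y} {f' : X' ⟶ Y} {c : C} {S : Sieve c}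
    {y : Y.obj (op c)} (s : Family f S y) (a : X ⟶ X') (w : a ≫ f' = f) : Family f' S y where
  val g hg := a.app _ (s.val g hg)
  map_val g hg k := by rw [← app_map, s.map_val]
  app_val g hg := (congrArg (fun t => t.app (op _) (s.val g hg)) w).trans (s.app_val g hg)

lemma SieveAlg.IsHom.over {J : StableSieves C} {X Y X' : Cᵒᵖ ⥤ Type u} {f : X ⟶ Y} {f' : X' ⟶ Y}
    {α : SieveAlg J f} {β : SieveAlg J f'} {a : X ⟶ X'} (h : IsHom α β a (𝟙 Y)) {c : C}
    (S : Sieve c) (hS : J.mem S) (y : Y.obj (op c)) (s : Family f S y) :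
    a.app (op c) (α.extend S hS y s) =
      β.extend S hS y (s.over a (h.w.trans (Category.comp_id f))) :=
  (h.app_extend S hS y s).trans (β.extend_congr rfl rfl fun _ _ _ => rfl)

namespace free

variable {J : StableSieves C} {X Y X' Y' : Cᵒᵖ ⥤ Type u} {f : X ⟶ Y} {f' : X' ⟶ Y'}

/-- The extension operations determined by an action of the free algebra. -/
def algOfAction (a : free J f ⟶ X) (w : a ≫ f = proj J f) (hu : leaf J f ≫ a = 𝟙 X) :
    SieveAlg J f where
  extend {c} S hS y s := a.app (op c) ((alg J f).extend S hS y (s.over (leaf J f) rfl))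
  app_extend {c} S hS y s := by
    have := congrArg (fun k => k.app (op c) ((alg J f).extend S hS y (s.over (leaf J f) rfl))) w
    exact this.trans ((alg J f).app_extend _ _ _ _)
  map_extend_of_mem {c} S hS y s d g hg := by
    rw [← app_map, (alg J f).map_extend_of_mem _ _ _ _ g hg]
    exact congrArg (fun k => k.app (op d) (s.val g hg)) hu
  map_extend {c} S hS y s d g := by
    rw [← app_map, (alg J f).map_extend]
    exact congrArg (a.app (op d)) ((alg J f).extend_congr rfl rfl fun g h h' => rfl)

/-- This is associativity evaluated at the formal extension of a family of generators of the free
algebra on `proj J f`: `mul` turns it into an extension in the free algebra on `f`, whereas `map J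
a` applies `a` to the members of the family. -/
lemma algOfAction_isHom (a : free J f ⟶ X) (w : a ≫ f = proj J f) (hu : leaf J f ≫ a = 𝟙 X)
    (ha : map J a (𝟙 Y) (w.trans (Category.comp_id _).symm) ≫ a = mul J f ≫ a) :
    (alg J f).IsHom (algOfAction a w hu) a (𝟙 Y) where
  w := w.trans (Category.comp_id _).symm
  app_extend {c} S hS y s := by
    have h := congrArg (fun k => k.app (op c) ((alg J (proj J f)).extend S hS y
      (s.over (leaf J (proj J f)) rfl))) ha
    change a.app _ ((map J a (𝟙 Y) (w.trans (Category.comp_id _).symm)).app _ _) =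
      a.app _ ((mul J f).app _ _) at h
    rw [mul_isHom.over, (map_isHom _ _ _).over] at h
    refine Eq.trans ?_ (h.symm.trans ?_)
    · refine congrArg (a.app (op c)) ((alg J f).extend_congr rfl rfl fun {d} g h h' => ?_)
      exact (congrArg (fun k => k.app (op d) (s.val g h)) leaf_mul).symm
    · refine congrArg (a.app (op c)) ((alg J f).extend_congr rfl rfl fun {d} g h h' => ?_)
      exact congrArg (fun k => k.app (op d) (s.val g h)) (leaf_map (J := J) (f := proj J f) (f' := f) a (𝟙 Y)
        (w.trans (Category.comp_id _).symm))

/-- The action of the free algebra on an algebra. -/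
def action (β : SieveAlg J f) : free J f ⟶ X :=
  lift β (𝟙 X) (𝟙 Y) (by simp)

lemma leaf_action (β : SieveAlg J f) : leaf J f ≫ action β = 𝟙 X :=
  leaf_lift _ _ _ _

lemma action_isHom (β : SieveAlg J f) : (alg J f).IsHom β (action β) (𝟙 Y) :=
  lift_isHom _ _ _ _

lemma map_action {α : SieveAlg J f} {β : SieveAlg J f'} {a : X ⟶ X'} {b : Y ⟶ Y'}
    (h : α.IsHom β a b) : map J a b h.w ≫ action β = action α ≫ a := by
  refine hom_ext (β := β) (b := b) ?_ ?_ ?_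
  · simpa using (map_isHom _ _ h.w).comp (action_isHom β)
  · simpa using (action_isHom α).comp h
  · rw [leaf_map_assoc, leaf_action, ← Category.assoc, leaf_action, Category.id_comp,
      Category.comp_id]

lemma action_algOfAction (a : free J f ⟶ X) (w : a ≫ f = proj J f) (hu : leaf J f ≫ a = 𝟙 X)
    (ha : map J a (𝟙 Y) (w.trans (Category.comp_id _).symm) ≫ a = mul J f ≫ a) :
    action (algOfAction a w hu) = a :=
  hom_ext (action_isHom _) (algOfAction_isHom a w hu ha) ((leaf_action _).trans hu.symm)

lemma algOfAction_action (β : SieveAlg J f) :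
    algOfAction (action β) ((action_isHom β).w.trans (Category.comp_id _)) (leaf_action β) = β := by
  refine SieveAlg.eq_of_extend fun {c} S hS y s => ?_
  refine ((action_isHom β).over S hS y _).trans ?_
  exact β.extend_congr rfl rfl fun {d} g h h' =>
    congrArg (fun k => k.app (op d) (s.val g h)) (leaf_action β)

lemma algOfAction_map {a : free J f ⟶ X} (w : a ≫ f = proj J f) (hu : leaf J f ≫ a = 𝟙 X)
    {a' : free J f' ⟶ X'} (w' : a' ≫ f' = proj J f') (hu' : leaf J f' ≫ a' = 𝟙 X')
    {k : X ⟶ X'} {l : Y ⟶ Y'} (wk : k ≫ f' = f ≫ l) (h : map J k l wk ≫ a' = a ≫ k) :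
    (algOfAction a w hu).IsHom (algOfAction a' w' hu') k l where
  w := wk
  app_extend {c} S hS y s := by
    refine (congrArg (fun k => k.app (op c) ((alg J f).extend S hS y
      (s.over (leaf J f) rfl))) h).symm.trans ?_
    change a'.app _ ((map J k l wk).app _ _) = _
    rw [(map_isHom _ _ _).app_extend]
    refine congrArg (a'.app (op c)) ((alg J f').extend_congr rfl rfl fun {d} g h h' => ?_)
    exact congrArg (fun k => k.app (op d) (s.val g h)) (leaf_map (J := J) k l wk)

end free

namespace StableSieves

open free

variable {J : StableSieves C}

lemma algebra_mk_congr {E : Type*} [Category* E] {T : Monad E} {A : E} {a a' : T.obj A ⟶ A}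
    (h : a = a') {hu : T.η.app A ≫ a = 𝟙 A} {hu' : T.η.app A ≫ a' = 𝟙 A}
    {ha : T.μ.app A ≫ a = T.map a ≫ a} {ha' : T.μ.app A ≫ a' = T.map a' ≫ a'} :
    Monad.Algebra.mk A a hu ha = Monad.Algebra.mk A a' hu' ha' := by
  subst h
  rfl

/-- The unit of the monad is the identity on codomains, so the unit law forces the structure map to
be the identity there. -/
lemma algebra_right (A : J.awfs.TrivFib) : A.a.right = 𝟙 A.A.right :=
  (Category.id_comp _).symm.trans (congrArg CommaMorphism.right A.unit)

/-- The structure map of a monad algebra. -/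
def algebraMap (A : J.awfs.TrivFib) : free J A.A.hom ⟶ A.A.left := A.a.left

lemma algebraMap_comp (A : J.awfs.TrivFib) : algebraMap A ≫ A.A.hom = proj J A.A.hom := by
  refine (Arrow.w A.a).trans ?_
  rw [algebra_right]
  exact Category.comp_id _

lemma leaf_algebraMap (A : J.awfs.TrivFib) : leaf J A.A.hom ≫ algebraMap A = 𝟙 _ :=
  congrArg CommaMorphism.left A.unit

lemma map_free_congr {X Y X' Y' : Cᵒᵖ ⥤ Type u} {f : X ⟶ Y} {f' : X' ⟶ Y'} {a : X ⟶ X'}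
    {b b' : Y ⟶ Y'} (h : b = b') (w : a ≫ f' = f ≫ b) (w' : a ≫ f' = f ≫ b') :
    free.map J a b w = free.map J a b' w' := by
  subst h
  rfl

lemma mul_algebraMap (A : J.awfs.TrivFib) :
    free.map J (algebraMap A) (𝟙 _) ((algebraMap_comp A).trans (Category.comp_id _).symm) ≫
      algebraMap A = mul J A.A.hom ≫ algebraMap A := by
  refine Eq.trans ?_ (congrArg CommaMorphism.left A.assoc).symm
  exact congrArg (fun k => k ≫ algebraMap A) (map_free_congr (algebra_right A).symm _
    (Arrow.w A.a))

/-- The extension operations of a monad algebra. -/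
def sieveAlgOfAlgebra (A : J.awfs.TrivFib) : SieveAlgCat J where
  arrow := A.A
  alg := algOfAction (algebraMap A) (algebraMap_comp A) (leaf_algebraMap A)

/-- The monad algebra given by extension operations. -/
def algebraOfSieveAlg (f : SieveAlgCat J) : J.awfs.TrivFib where
  A := f.arrow
  a := Arrow.homMk (f := J.fact.R.obj f.arrow) (g := f.arrow)
    (u := action f.alg) (v := 𝟙 f.arrow.right) (action_isHom f.alg).w
  unit := by
    ext1
    · exact leaf_action f.alg
    · exact Category.id_comp (𝟙 f.arrow.right)
  assoc := by
    ext1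
    · exact (map_action (action_isHom f.alg)).symm
    · rfl

variable (J)

/-- The functor from monad algebras to algebras. -/
def toSieveAlgCat : J.awfs.TrivFib ⥤ SieveAlgCat J where
  obj A := sieveAlgOfAlgebra A
  map {A B} φ := ⟨φ.f, algOfAction_map (algebraMap_comp A) (leaf_algebraMap A) (algebraMap_comp B)
    (leaf_algebraMap B) (Arrow.w φ.f) (congrArg CommaMorphism.left φ.h)⟩

/-- The functor from algebras to monad algebras. -/
def ofSieveAlgCat : SieveAlgCat J ⥤ J.awfs.TrivFib where
  obj f := algebraOfSieveAlg f
  map φ :=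
    { f := φ.sq
      h := by
        ext1
        · exact map_action φ.isHom
        · exact (Category.comp_id φ.sq.right).trans (Category.id_comp φ.sq.right).symm }

lemma algebraOfSieveAlg_sieveAlgOfAlgebra (A : J.awfs.TrivFib) :
    algebraOfSieveAlg (sieveAlgOfAlgebra A) = A := by
  have h : (algebraOfSieveAlg (sieveAlgOfAlgebra A)).a = A.a := by
    ext1
    · exact action_algOfAction _ (algebraMap_comp A) (leaf_algebraMap A) (mul_algebraMap A)
    · exact (algebra_right A).symm
  exact algebra_mk_congr h

lemma isoOver_sieveAlgCat : IsoOver J.awfs.trivFibForget (SieveAlgCat.forget J) :=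
  IsoOver.of_obj J.toSieveAlgCat J.ofSieveAlgCat rfl rfl
    J.algebraOfSieveAlg_sieveAlgOfAlgebra
    fun f => congrArg (SieveAlgCat.mk f.arrow) (algOfAction_action f.alg)

end StableSieves

end SieveAlgCat

end UniformFibrations

end

noncomputable section

namespace UniformFibrations

open Opposite

/-! ### Right maps and algebras -/

variable {C : Type u} [SmallCategory C]

lemma mem_sieveOf {M : MorphismProperty (Cᵒᵖ ⥤ Type u)} [M.IsStableUnderBaseChange]
    {A B : Cᵒᵖ ⥤ Type u} {m : A ⟶ B} [Mono m] (hm : M m) {c : C} (b : B.obj (op c)) :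
    M (sieveOf m b).functorInclusion :=
  M.of_isPullback (isPullback_sieveOf m b) hm

/-- The sieves whose inclusion into the representable presheaf is in `M`. -/
def sievesOf (M : MorphismProperty (Cᵒᵖ ⥤ Type u)) [M.IsStableUnderBaseChange] :
    StableSieves C where
  mem S := M S.functorInclusion
  pullback_mem {c d} g S hS := by
    rw [← sieveOf_functorInclusion]
    exact mem_sieveOf hS _

/-- The square given by a family. -/
def Family.square {f : Arrow (Cᵒᵖ ⥤ Type u)} {c : C} {S : Sieve c} {y : f.right.obj (op c)}
    (s : Family f.hom S y) : Arrow.mk S.functorInclusion ⟶ f :=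
  Arrow.homMk (f := Arrow.mk S.functorInclusion) (g := f)
    (u := { app := fun d => TypeCat.ofHom fun g => s.val g.1 g.2
            naturality := fun d d' k => by
              ext g
              exact (s.map_val g.1 g.2 k.unop).symm })
    (v := yonedaEquiv.symm y) (by
      ext d g
      exact s.app_val g.1 g.2)

/-- The square between a pulled back sieve and the sieve itself. -/
def sievePullback {c d : C} (S : Sieve c) (g : d ⟶ c) :
    Arrow.mk (S.pullback g).functorInclusion ⟶ Arrow.mk S.functorInclusion :=
  Arrow.homMk (f := Arrow.mk (S.pullback g).functorInclusion) (g := Arrow.mk S.functorInclusion)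
    (u := { app := fun e => TypeCat.ofHom fun k => ⟨k.1 ≫ g, mem_of_pullback k.2⟩
            naturality := fun e e' l => by
              ext k
              exact Subtype.ext (Category.assoc _ _ _) })
    (v := yoneda.map g) rfl

lemma sievePullback_isPullback {c d : C} (S : Sieve c) (g : d ⟶ c) :
    IsPullback (sievePullback S g).left (S.pullback g).functorInclusion S.functorInclusion
      (sievePullback S g).right := by
  rw [isPullback_iff_elementwise]
  refine ⟨rfl, fun e => ⟨fun x y _ h => Subtype.ext h, fun x y h => ?_⟩⟩
  refine ⟨⟨y, ?_⟩, Subtype.ext h.symm, rfl⟩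
  have hx := x.2
  change x.1 = y ≫ g at h
  rw [h] at hx
  exact hx

/-- A full subcategory of the category of maps in `M` and pullback squares that contains, up to
isomorphism, the inclusions of all sieves in `M`. -/
structure SieveDense (M : MorphismProperty (Cᵒᵖ ⥤ Type u)) [M.IsStableUnderBaseChange]
    {I : Type u₁} [Category.{v₁} I] (U : I ⥤ Arrow (Cᵒᵖ ⥤ Type u)) where
  mem : ∀ i, M (U.obj i).hom
  isPullback : ∀ {i j : I} (σ : i ⟶ j),
    IsPullback (U.map σ).left (U.obj i).hom (U.obj j).hom (U.map σ).right
  full : ∀ {i j : I} (sq : U.obj i ⟶ U.obj j),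
    IsPullback sq.left (U.obj i).hom (U.obj j).hom sq.right → ∃ σ, U.map σ = sq
  /-- the object corresponding to a sieve -/
  obj : ∀ {c : C} (S : Sieve c), (sievesOf M).mem S → I
  /-- the isomorphism with the inclusion of the sieve -/
  iso : ∀ {c : C} (S : Sieve c) (hS : (sievesOf M).mem S),
    U.obj (obj S hS) ≅ Arrow.mk S.functorInclusion

namespace SieveDense

variable {M : MorphismProperty (Cᵒᵖ ⥤ Type u)} [M.IsStableUnderBaseChange]
  {I : Type u₁} [Category.{v₁} I] {U : I ⥤ Arrow (Cᵒᵖ ⥤ Type u)} (D : SieveDense M U)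

lemma isPullback_of_iso {E : Type*} [Category* E] {f g : Arrow E} (e : f ≅ g) :
    IsPullback e.hom.left f.hom g.hom e.hom.right :=
  IsPullback.of_horiz_isIso ⟨Arrow.w e.hom⟩

/-- The right map given by extension operations. -/
def rightMapOfSieveAlg (M1 : M ≤ MorphismProperty.monomorphisms _) (f : SieveAlgCat (sievesOf M)) :
    RightMap U where
  arrow := f.arrow
  lift i sq :=
    haveI : Mono (U.obj i).hom := M1 _ (D.mem i)
    f.alg.diag (U.obj i).hom (fun b => mem_sieveOf (D.mem i) b) sq.left sq.right (Arrow.w sq)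
  fac_left i sq := by
    have : Mono (U.obj i).hom := M1 _ (D.mem i)
    exact f.alg.comp_diag _ _ _ _ _
  fac_right i sq := by
    have : Mono (U.obj i).hom := M1 _ (D.mem i)
    exact f.alg.diag_comp _ _ _ _ _
  naturality {i j} σ sq := by
    have : Mono (U.obj i).hom := M1 _ (D.mem i)
    have : Mono (U.obj j).hom := M1 _ (D.mem j)
    exact f.alg.diag_of_isPullback _ _ _ _ _ _ _ (D.isPullback σ) _

/-- The functor from algebras to right maps. -/
def toRightMap (M1 : M ≤ MorphismProperty.monomorphisms _) :
    SieveAlgCat (sievesOf M) ⥤ RightMap U where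
  obj f := D.rightMapOfSieveAlg M1 f
  map {f g} φ := ⟨φ.sq, fun i s => by
    have : Mono (U.obj i).hom := M1 _ (D.mem i)
    exact φ.isHom.diag_comp _ (fun b => mem_sieveOf (D.mem i) b) _ _ _ _⟩

/-- The filler of a square from the inclusion of a sieve to a right map. -/
def sieveLift (r : RightMap U) {c : C} (S : Sieve c) (hS : (sievesOf M).mem S)
    (sq : Arrow.mk S.functorInclusion ⟶ r.arrow) : yoneda.obj c ⟶ r.arrow.left :=
  (D.iso S hS).inv.right ≫ r.lift (D.obj S hS) ((D.iso S hS).hom ≫ sq)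

/-- Pasting `σ` with the chosen isomorphism gives a pullback square between objects of `I`. By
fullness it comes from a morphism of `I`, to which naturality of the right map applies. -/
lemma sieveLift_naturality (r : RightMap U) {c : C} (S : Sieve c) (hS : (sievesOf M).mem S) {i : I}
    (σ : Arrow.mk S.functorInclusion ⟶ U.obj i)
    (hσ : IsPullback σ.left S.functorInclusion (U.obj i).hom σ.right) (sq : U.obj i ⟶ r.arrow) :
    σ.right ≫ r.lift i sq = D.sieveLift r S hS (σ ≫ sq) := by
  obtain ⟨τ, hτ⟩ := D.full ((D.iso S hS).hom ≫ σ)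
    ((isPullback_of_iso (D.iso S hS)).paste_horiz hσ)
  have h := r.naturality τ sq
  rw [hτ, Category.assoc] at h
  refine Eq.trans ?_ (congrArg ((D.iso S hS).inv.right ≫ ·) h)
  rw [← Category.assoc, ← Arrow.comp_right, Iso.inv_hom_id_assoc]

lemma sieveLift_fac_left (r : RightMap U) {c : C} (S : Sieve c) (hS : (sievesOf M).mem S)
    (sq : Arrow.mk S.functorInclusion ⟶ r.arrow) :
    S.functorInclusion ≫ D.sieveLift r S hS sq = sq.left := by
  have h₁ : (D.iso S hS).inv.left ≫ (U.obj _).hom =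
    S.functorInclusion ≫ (D.iso S hS).inv.right := Arrow.w (D.iso S hS).inv
  rw [sieveLift, ← Category.assoc, ← h₁, Category.assoc, r.fac_left, ← Arrow.comp_left,
    Iso.inv_hom_id_assoc]

lemma sieveLift_fac_right (r : RightMap U) {c : C} (S : Sieve c) (hS : (sievesOf M).mem S)
    (sq : Arrow.mk S.functorInclusion ⟶ r.arrow) :
    D.sieveLift r S hS sq ≫ r.arrow.hom = sq.right := by
  rw [sieveLift, Category.assoc, r.fac_right, ← Arrow.comp_right, Iso.inv_hom_id_assoc]

lemma sieveLift_pullback (r : RightMap U) {c d : C} (S : Sieve c)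
    (hS : (sievesOf M).mem S) (g : d ⟶ c) (sq : Arrow.mk S.functorInclusion ⟶ r.arrow) :
    yoneda.map g ≫ D.sieveLift r S hS sq =
      D.sieveLift r (S.pullback g) ((sievesOf M).pullback_mem g hS) (sievePullback S g ≫ sq) := by
  have h := D.sieveLift_naturality r (S.pullback g) ((sievesOf M).pullback_mem g hS)
    (sievePullback S g ≫ (D.iso S hS).inv)
    ((sievePullback_isPullback S g).paste_horiz (isPullback_of_iso (D.iso S hS).symm))
    ((D.iso S hS).hom ≫ sq)
  rw [Category.assoc, Iso.inv_hom_id_assoc, Arrow.comp_right, Category.assoc] at h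
  exact h

/-- The extension operations of a right map. -/
def sieveAlgOfRightMap (r : RightMap U) : SieveAlg (sievesOf M) r.arrow.hom where
  extend S hS y s := yonedaEquiv (D.sieveLift r S hS s.square)
  app_extend S hS y s := by
    rw [← yonedaEquiv_comp, sieveLift_fac_right]
    exact Equiv.apply_symm_apply _ _
  map_extend_of_mem S hS y s d g hg := by
    rw [map_yonedaEquiv]
    exact congrArg (fun k => k.app (op d) ⟨g, hg⟩) (D.sieveLift_fac_left r S hS s.square)
  map_extend S hS y s d g := by
    rw [yonedaEquiv_naturality, sieveLift_pullback]
    refine congrArg (fun sq => yonedaEquiv (D.sieveLift r _ _ sq)) ?_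
    ext1
    · rfl
    · exact yonedaEquiv_symm_naturality_left g _ y

/-- The functor from right maps to algebras. -/
def ofRightMap : RightMap U ⥤ SieveAlgCat (sievesOf M) where
  obj r := ⟨r.arrow, D.sieveAlgOfRightMap r⟩
  map {r r'} φ :=
    { sq := φ.sq
      isHom :=
        { w := Arrow.w φ.sq
          app_extend := fun S hS y s => by
            refine (yonedaEquiv_comp (D.sieveLift r S hS s.square) φ.sq.left).symm.trans ?_
            refine congrArg yonedaEquiv ?_
            unfold sieveLift
            rw [Category.assoc, φ.lift_comp, Category.assoc]
            refine congrArg (fun k => (D.iso S hS).inv.right ≫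
              r'.lift (D.obj S hS) ((D.iso S hS).hom ≫ k)) ?_
            ext1
            · rfl
            · exact yonedaEquiv_symm_naturality_right _ φ.sq.right y } }

lemma sieveAlgOfRightMap_rightMapOfSieveAlg (M1 : M ≤ MorphismProperty.monomorphisms _)
    (f : SieveAlgCat (sievesOf M)) :
    D.sieveAlgOfRightMap (D.rightMapOfSieveAlg M1 f) = f.alg := by
  refine SieveAlg.eq_of_extend fun {c} S hS y s => ?_
  have : Mono (U.obj (D.obj S hS)).hom := M1 _ (D.mem _)
  -- The filler is computed at the object representing `S`. An isomorphism is a pullback square, so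
  -- the filler can be transported to the inclusion of `S` (`h₁`, `h₂`), where it is the given
  -- extension (`h₃`); `h₄` replaces the square by an equal one.
  have h₁ := f.alg.diag_of_isPullback (U.obj (D.obj S hS)).hom
    (fun b => mem_sieveOf (D.mem _) b) ((D.iso S hS).hom ≫ s.square).left
    ((D.iso S hS).hom ≫ s.square).right (Arrow.w _) S.functorInclusion (fun b => mem_sieveOf hS b)
    (isPullback_of_iso (D.iso S hS).symm) (Arrow.w ((D.iso S hS).inv ≫ (D.iso S hS).hom ≫ s.square))
  have h₂ : (D.iso S hS).inv ≫ (D.iso S hS).hom ≫ s.square = s.square :=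
    Iso.inv_hom_id_assoc _ _
  have h₃ := f.alg.diag_functorInclusion hS (fun b => mem_sieveOf hS b) s.square.left
    s.square.right (Arrow.w s.square) (s.cast (yonedaEquiv.apply_symm_apply y).symm)
    (fun g hg => rfl)
  have h₄ : ∀ sq : Arrow.mk S.functorInclusion ⟶ f.arrow, sq = s.square →
      f.alg.diag S.functorInclusion (fun b => mem_sieveOf hS b) sq.left sq.right (Arrow.w sq) =
        f.alg.diag S.functorInclusion (fun b => mem_sieveOf hS b) s.square.left s.square.right
          (Arrow.w s.square) := by
    rintro _ rfl
    rfl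
  refine (congrArg yonedaEquiv (h₁.trans (h₄ _ h₂))).trans (h₃.trans ?_)
  exact f.alg.extend_congr rfl (yonedaEquiv.apply_symm_apply y) fun g h h' => rfl

/-- Naturality along the pullback square of `isPullback_sieveOf` determines a filler at `b` from the
filler for the sieve of `b`, which is the data from which `diag` is built. -/
lemma rightMapOfSieveAlg_lift (M1 : M ≤ MorphismProperty.monomorphisms _) (r : RightMap U) (i : I)
    (sq : U.obj i ⟶ r.arrow) :
    (D.rightMapOfSieveAlg M1 ⟨r.arrow, D.sieveAlgOfRightMap r⟩).lift i sq = r.lift i sq := by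
  have : Mono (U.obj i).hom := M1 _ (D.mem i)
  have key : ∀ {c : C} (b : (U.obj i).right.obj (op c)),
      ((D.rightMapOfSieveAlg M1 ⟨r.arrow, D.sieveAlgOfRightMap r⟩).lift i sq).app (op c) b =
        (r.lift i sq).app (op c) b := by
    intro c b
    have hS : (sievesOf M).mem (sieveOf (U.obj i).hom b) := mem_sieveOf (D.mem i) b
    have h₁ := D.sieveLift_naturality r (sieveOf (U.obj i).hom b) hS
      (Arrow.homMk (f := Arrow.mk (sieveOf (U.obj i).hom b).functorInclusion)
        (u := sieveOfFst (U.obj i).hom b) (v := yonedaEquiv.symm b)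
        (isPullback_sieveOf (U.obj i).hom b).w) (isPullback_sieveOf (U.obj i).hom b) sq
    refine Eq.trans ?_ ((congrArg yonedaEquiv h₁).symm.trans ?_)
    · refine congrArg (fun sq => yonedaEquiv (D.sieveLift r _ hS sq)) ?_
      ext1
      · rfl
      · exact (yonedaEquiv_symm_naturality_right _ sq.right b).symm
    · refine (yonedaEquiv_comp (yonedaEquiv.symm b) (r.lift i sq)).trans ?_
      rw [Equiv.apply_symm_apply]
  ext c b
  exact key b

lemma rightMap_mk_congr {f : Arrow (Cᵒᵖ ⥤ Type u)}
    {l l' : ∀ (i : I) (_ : U.obj i ⟶ f), (U.obj i).right ⟶ f.left}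
    (h : ∀ i sq, l i sq = l' i sq) {h₁ h₂ h₃ h₁' h₂' h₃'} :
    RightMap.mk (u := U) f l h₁ h₂ h₃ = RightMap.mk (u := U) f l' h₁' h₂' h₃' := by
  obtain rfl : l = l' := by
    funext i sq
    exact h i sq
  rfl

lemma isoOver_rightMap (D : SieveDense M U) (M1 : M ≤ MorphismProperty.monomorphisms _) :
    IsoOver (SieveAlgCat.forget (sievesOf M)) (RightMap.forget U) :=
  IsoOver.of_obj (D.toRightMap M1) D.ofRightMap rfl rfl
    (fun f => congrArg (SieveAlgCat.mk f.arrow) (D.sieveAlgOfRightMap_rightMapOfSieveAlg M1 f))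
    fun r => rightMap_mk_congr (D.rightMapOfSieveAlg_lift M1 r)

end SieveDense

/-! ### Algebraic freeness on M and generation by a small category of sieves. -/

section Generation

variable {M : MorphismProperty (Cᵒᵖ ⥤ Type u)} [M.IsStableUnderBaseChange]

/-- The category of all maps in `M` and pullback squares contains the inclusions of sieves. -/
def sieveDenseIncl : SieveDense M (CartSubcategory.incl M) where
  mem i := i.2
  isPullback σ := σ.hom.2
  full sq h := ⟨⟨⟨sq, h⟩⟩, rfl⟩
  obj S hS := ⟨⟨Arrow.mk S.functorInclusion⟩, hS⟩
  iso S _ := Iso.refl (Arrow.mk S.functorInclusion)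

/-- The object of the category of maps in `M` and pullback squares that corresponds to a sieve. -/
def sieveObj (M : MorphismProperty (Cᵒᵖ ⥤ Type u)) [M.IsStableUnderBaseChange]
    (p : Σ c : C, {S : Sieve c // (sievesOf M).mem S}) : CartSubcategory M :=
  ⟨⟨Arrow.mk p.2.1.functorInclusion⟩, p.2.2⟩

/-- The small category of inclusions of sieves in `M`. -/
def sieveDenseSmall :
    SieveDense M (inducedFunctor (sieveObj M) ⋙ CartSubcategory.incl M) where
  mem i := i.2.2
  isPullback σ := σ.hom.hom.2
  full sq h := ⟨⟨⟨⟨sq, h⟩⟩⟩, rfl⟩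
  obj {c} S hS := (⟨c, S, hS⟩ : Σ c : C, {S : Sieve c // (sievesOf M).mem S})
  iso S _ := Iso.refl (Arrow.mk S.functorInclusion)

lemma algebraicallyFree_incl (M1 : M ≤ MorphismProperty.monomorphisms _) :
    (sievesOf M).awfs.AlgebraicallyFree (CartSubcategory.incl M) :=
  (sievesOf M).isoOver_sieveAlgCat.trans (sieveDenseIncl.isoOver_rightMap M1)

/-- Sieves on objects of a small category form a small set, and their inclusions already determine
the same algebras as the whole of M. -/
lemma cofibrantlyGenerated_awfs (M1 : M ≤ MorphismProperty.monomorphisms _) :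
    AWFS.CofibrantlyGenerated.{u} (sievesOf M).awfs :=
  ⟨InducedCategory (CartSubcategory M) (sieveObj M), inferInstance, _,
    (sievesOf M).isoOver_sieveAlgCat.trans (sieveDenseSmall.isoOver_rightMap M1)⟩

end Generation

end UniformFibrations

end

noncomputable section

namespace UniformFibrations

open Opposite

variable {C : Type u} [SmallCategory C]

/-! ### Pullback squares of free algebras -/

namespace free

variable {J : StableSieves C} {X Y X' Y' : Cᵒᵖ ⥤ Type u} {f : X ⟶ Y} {f' : X' ⟶ Y'}

lemma map_comp_map_eq {X₁ Y₁ X₂ Y₂ : Cᵒᵖ ⥤ Type u} {f₁ : X₁ ⟶ Y₁} {f₂ : X₂ ⟶ Y₂}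
    {a₁ : X ⟶ X₁} {b₁ : Y ⟶ Y₁} {a₁' : X₁ ⟶ X'} {b₁' : Y₁ ⟶ Y'}
    {a₂ : X ⟶ X₂} {b₂ : Y ⟶ Y₂} {a₂' : X₂ ⟶ X'} {b₂' : Y₂ ⟶ Y'}
    (w₁ : a₁ ≫ f₁ = f ≫ b₁) (w₁' : a₁' ≫ f' = f₁ ≫ b₁')
    (w₂ : a₂ ≫ f₂ = f ≫ b₂) (w₂' : a₂' ≫ f' = f₂ ≫ b₂')
    (ha : a₁ ≫ a₁' = a₂ ≫ a₂') (hb : b₁ ≫ b₁' = b₂ ≫ b₂') :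
    map J a₁ b₁ w₁ ≫ map J a₁' b₁' w₁' = map J a₂ b₂ w₂ ≫ map J a₂' b₂' w₂' := by
  refine hom_ext (β := alg J f') (b := b₁ ≫ b₁') ((map_isHom _ _ _).comp (map_isHom _ _ _))
    (hb ▸ (map_isHom _ _ _).comp (map_isHom _ _ _)) ?_
  rw [leaf_map_assoc, leaf_map, leaf_map_assoc, leaf_map, ← Category.assoc, ha, Category.assoc]

lemma map_leaf_app (a : X ⟶ X') (b : Y ⟶ Y') (w : a ≫ f' = f ≫ b) {c : C} (x : X.obj (op c)) :
    (map J a b w).app (op c) ((leaf J f).app (op c) x) = (leaf J f').app (op c) (a.app (op c) x) :=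
  congrArg (fun k => k.app (op c) x) (leaf_map (J := J) a b w)

lemma map_node_app (a : X ⟶ X') (b : Y ⟶ Y') (w : a ≫ f' = f ≫ b) {c : C} {S : Sieve c}
    (hS : J.mem S) (h : ¬ S (𝟙 c)) (y : Y.obj (op c)) (s : Family (proj J f) S y) :
    (map J a b w).app (op c) (node S hS h y s) =
      node S hS h (b.app (op c) y) (s.push _ b (map_isHom a b w).w) := by
  rw [← alg_extend_of_not_mem, (map_isHom a b w).app_extend, alg_extend_of_not_mem hS h]

lemma leaf_ne_node {c : C} {S : Sieve c} (hS : J.mem S) (h : ¬ S (𝟙 c)) (y : Y.obj (op c))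
    (s : Family (proj J f) S y) (x : X.obj (op c)) :
    (leaf J f).app (op c) x ≠ node S hS h y s :=
  fun e => by injection congrArg Subtype.val e

lemma leaf_injective {c : C} {x x' : X.obj (op c)}
    (h : (leaf J f).app (op c) x = (leaf J f).app (op c) x') : x = x' :=
  Tree.leaf.inj (congrArg Subtype.val h)

/-- Base labels are left out of the conclusion: where this is applied, the labels upstairs are
compared through `proj`. -/
lemma node_inj {c : C} {S S' : Sieve c} {hS : J.mem S} {hS' : J.mem S'} {h : ¬ S (𝟙 c)}
    {h' : ¬ S' (𝟙 c)} {y y' : Y.obj (op c)} {s : Family (proj J f) S y}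
    {s' : Family (proj J f) S' y'} (e : node S hS h y s = node S' hS' h' y' s') :
    S = S' ∧ ∀ {d : C} (g : d ⟶ c) (hg : S g) (hg' : S' g), s.val g hg = s'.val g hg' := by
  obtain ⟨rfl, -, e₃⟩ := Tree.node.inj (congrArg Subtype.val e)
  refine ⟨rfl, fun {d} g hg hg' => Subtype.ext ?_⟩
  exact congrFun (congrFun (congrFun (eq_of_heq e₃) d) g) hg

/-- Trees carry no identifications, so induction applies. Leaves lift uniquely because the given
square is a pullback; a node over `b y` lifts to a node with the same sieve, label `y` and lifted
subtrees. Injectivity comes first because it makes the chosen lifts of the subtrees a compatible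
family. -/
lemma map_isPullback (a : X ⟶ X') (b : Y ⟶ Y') (h : IsPullback a f f' b) :
    IsPullback (map J a b h.w) (proj J f) (proj J f') b := by
  rw [isPullback_iff_elementwise] at h
  obtain ⟨w, h⟩ := h
  have inj : ∀ {c : C} (t t' : (free J f).obj (op c)),
      (map J a b w).app (op c) t = (map J a b w).app (op c) t' →
        (proj J f).app (op c) t = (proj J f).app (op c) t' → t = t' := by
    intro c t
    induction t using induction with
    | h₁ x =>
      intro t' e₁ e₂
      induction t' using induction with
      | h₁ x' =>
        rw [map_leaf_app, map_leaf_app] at e₁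
        exact congrArg _ ((h _).1 _ _ (leaf_injective e₁) e₂)
      | h₂ S hS hne y s _ =>
        rw [map_leaf_app, map_node_app] at e₁
        exact (leaf_ne_node _ _ _ _ _ e₁).elim
    | h₂ S hS hne y s ih =>
      intro t' e₁ e₂
      induction t' using induction with
      | h₁ x' =>
        rw [map_leaf_app, map_node_app] at e₁
        exact (leaf_ne_node _ _ _ _ _ e₁.symm).elim
      | h₂ S' hS' hne' y' s' _ =>
        rw [map_node_app, map_node_app] at e₁
        obtain ⟨rfl, e₃⟩ := node_inj e₁
        change y = y' at e₂
        subst e₂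
        congr 1
        ext d g hg
        refine ih g hg _ (e₃ g hg hg) ?_
        rw [s.app_val, s'.app_val]
  have surj : ∀ {c : C} (t' : (free J f').obj (op c)) (y : Y.obj (op c)),
      (proj J f').app (op c) t' = b.app (op c) y →
        ∃ t, (map J a b w).app (op c) t = t' ∧ (proj J f).app (op c) t = y := by
    intro c t'
    induction t' using induction with
    | h₁ x' =>
      intro y e
      obtain ⟨x, rfl, hx⟩ := (h _).2 x' y e
      exact ⟨(leaf J f).app _ x, map_leaf_app a b w x, hx⟩
    | @h₂ c S hS hne y' s' ih =>
      intro y e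
      change y' = b.app (op c) y at e
      subst e
      have ih' : ∀ {d : C} (g : d ⟶ c) (hg : S g), ∃ t,
          (map J a b w).app (op d) t = s'.val g hg ∧ (proj J f).app (op d) t = Y.map g.op y :=
        fun {d} g hg => ih g hg _ (by rw [s'.app_val, app_map])
      choose v hv₁ hv₂ using @ih'
      let s : Family (proj J f) S y :=
        { val := fun {d} g hg => v g hg
          map_val := fun {d e} g hg k => inj _ _
            (by rw [app_map, hv₁, hv₁, s'.map_val]) (by rw [app_map, hv₂, hv₂, map_map])
          app_val := fun {d} g hg => hv₂ g hg }
      refine ⟨node S hS hne y s, ?_, rfl⟩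
      rw [map_node_app]
      congr 1
      ext d g hg
      exact hv₁ g hg
  rw [isPullback_iff_elementwise]
  exact ⟨(map_isHom a b w).w, fun c => ⟨fun t t' => inj t t', fun t' y => surj t' y⟩⟩

end free

/-! ### Coalgebras for the copointed endofunctor -/

namespace StableSieves

open free

variable {J : StableSieves C}

/-- The structure map of a coalgebra, on codomains. -/
def coalgebraMap (c : J.awfs.Cof) : c.obj.V.right ⟶ free J c.obj.V.hom :=
  c.obj.str.right

lemma coalgebraMap_proj (c : J.awfs.Cof) : coalgebraMap c ≫ proj J c.obj.V.hom = 𝟙 _ :=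
  congrArg CommaMorphism.right c.property

lemma comp_coalgebraMap (c : J.awfs.Cof) :
    c.obj.V.hom ≫ coalgebraMap c = leaf J c.obj.V.hom := by
  have h : c.obj.str.left = 𝟙 _ :=
    (Category.comp_id _).symm.trans (congrArg CommaMorphism.left c.property)
  refine (Arrow.w c.obj.str).symm.trans ?_
  rw [h]
  exact Category.id_comp _

lemma coalgebraMap_naturality {c d : J.awfs.Cof} (φ : c ⟶ d) :
    coalgebraMap c ≫ free.map J φ.hom.f.left φ.hom.f.right (Arrow.w φ.hom.f) =
      φ.hom.f.right ≫ coalgebraMap d :=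
  congrArg CommaMorphism.right φ.hom.h

/-- The copointing is the identity on domains, so a coalgebra structure is only its codomain
component. Lifting a functor to `Cof` amounts to choosing such sections naturally. -/
lemma exists_lift_cof {K : Type u₁} [Category.{v₁} K] (H : K ⥤ Arrow (Cᵒᵖ ⥤ Type u))
    (l : ∀ k, (H.obj k).right ⟶ free J (H.obj k).hom)
    (hl : ∀ k, (H.obj k).hom ≫ l k = leaf J (H.obj k).hom)
    (hp : ∀ k, l k ≫ proj J (H.obj k).hom = 𝟙 _)
    (hn : ∀ {k k' : K} (φ : k ⟶ k'),
      l k ≫ free.map J (H.map φ).left (H.map φ).right (Arrow.w (H.map φ)) =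
        (H.map φ).right ≫ l k') :
    ∃ F : K ⥤ J.awfs.Cof, F ⋙ J.awfs.cofForget = H :=
  ⟨{ obj := fun k =>
      ⟨{ V := H.obj k
         str := Arrow.homMk (f := H.obj k) (g := J.fact.L.obj (H.obj k)) (u := 𝟙 _) (v := l k)
          ((Category.id_comp _).trans (hl k).symm) }, by
        ext1
        · exact Category.comp_id _
        · exact hp k⟩
     map := fun φ => ObjectProperty.homMk
      { f := H.map φ
        h := by
          ext1
          · exact (Category.id_comp _).trans (Category.comp_id _).symm
          · exact hn φ }
     map_id := fun k => by
      apply ObjectProperty.hom_ext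
      apply Endofunctor.Coalgebra.Hom.ext
      exact H.map_id k
     map_comp := fun φ ψ => by
      apply ObjectProperty.hom_ext
      apply Endofunctor.Coalgebra.Hom.ext
      exact H.map_comp φ ψ }, rfl⟩

/-- The empty family. -/
def emptyFamily {X Y : Cᵒᵖ ⥤ Type u} (f : X ⟶ Y) {c : C} (y : Y.obj (op c)) :
    Family f (⊥ : Sieve c) y where
  val _ h := h.elim
  map_val _ h := h.elim
  app_val _ h := h.elim

/-- Extending the empty family over each element gives the section; it is natural because there is
only one empty family over an element. -/
lemma exists_bot_lift (h : ∀ c : C, J.mem (⊥ : Sieve c)) :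
    ∃ F : (Cᵒᵖ ⥤ Type u) ⥤ J.awfs.Cof, F ⋙ J.awfs.cofForget = botFunctor (Cᵒᵖ ⥤ Type u) := by
  refine exists_lift_cof _ (fun X =>
    { app := fun c => TypeCat.ofHom fun x =>
        (alg J (initial.to X)).extend ⊥ (h c.unop) x (emptyFamily _ x)
      naturality := fun c d g => by
        ext x
        refine Eq.trans ?_ ((alg J (initial.to X)).map_extend ⊥ (h c.unop) x
          (emptyFamily (proj J (initial.to X)) x) g.unop).symm
        exact (alg J (initial.to X)).extend_congr rfl rfl fun g h => h.elim })
    ?_ ?_ ?_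
  · intro X
    exact initialIsInitial.hom_ext _ _
  · intro X
    ext c x
    exact (alg J (initial.to X)).app_extend _ _ _ _
  · intro X X' φ
    ext c x
    refine ((map_isHom _ _ (Arrow.w ((botFunctor _).map φ))).app_extend _ _ _ _).trans ?_
    exact (alg J (initial.to X')).extend_congr rfl rfl fun g h => h.elim

section

variable {A B Y A' B' Y' : Cᵒᵖ ⥤ Type u} {g : A ⟶ B} {h : Y ⟶ B} {g' : A' ⟶ B'} {h' : Y' ⟶ B'}

/-- The pullback of a coalgebra structure map. -/
def pullbackCoalgebraMap (l : B ⟶ free J g) (hl : l ≫ proj J g = 𝟙 B) (h : Y ⟶ B) :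
    Y ⟶ free J (pullback.snd g h) :=
  (map_isPullback _ _ (IsPullback.of_hasPullback g h)).lift (h ≫ l) (𝟙 Y)
    (by rw [Category.assoc, hl, Category.comp_id, Category.id_comp])

variable (l : B ⟶ free J g) (hl : l ≫ proj J g = 𝟙 B) (l' : B' ⟶ free J g')
  (hl' : l' ≫ proj J g' = 𝟙 B')

lemma pullbackCoalgebraMap_map : pullbackCoalgebraMap l hl h ≫
    free.map J (pullback.fst g h) h pullback.condition = h ≫ l :=
  IsPullback.lift_fst _ _ _ _

lemma pullbackCoalgebraMap_proj : pullbackCoalgebraMap l hl h ≫ proj J _ = 𝟙 Y :=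
  IsPullback.lift_snd _ _ _ _

lemma snd_pullbackCoalgebraMap (hg : g ≫ l = leaf J g) :
    pullback.snd g h ≫ pullbackCoalgebraMap l hl h = leaf J _ := by
  refine (map_isPullback _ _ (IsPullback.of_hasPullback g h)).hom_ext ?_ ?_
  · rw [Category.assoc, pullbackCoalgebraMap_map, leaf_map, ← hg, pullback.condition_assoc]
  · rw [Category.assoc, pullbackCoalgebraMap_proj, leaf_proj, Category.comp_id]

lemma pullbackCoalgebraMap_naturality (a : A ⟶ A') (b : B ⟶ B') (w : a ≫ g' = g ≫ b)
    (e : l ≫ free.map J a b w = b ≫ l') (y : Y ⟶ Y') (hy : y ≫ h' = h ≫ b) :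
    pullbackCoalgebraMap l hl h ≫
        free.map J (pullback.map g h g' h' a y b w.symm hy.symm) y (pullback.lift_snd _ _ _) =
      y ≫ pullbackCoalgebraMap l' hl' h' := by
  refine (map_isPullback _ _ (IsPullback.of_hasPullback g' h')).hom_ext ?_ ?_
  · rw [Category.assoc, Category.assoc, pullbackCoalgebraMap_map,
      map_comp_map_eq _ _ pullback.condition w (pullback.lift_fst _ _ _) hy, ← Category.assoc,
      pullbackCoalgebraMap_map, Category.assoc, e, ← Category.assoc, ← hy, Category.assoc]
  · rw [Category.assoc, Category.assoc, (map_isHom _ _ _).w, pullbackCoalgebraMap_proj,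
      ← Category.assoc, pullbackCoalgebraMap_proj, Category.id_comp, Category.comp_id]

end

lemma exists_pullback_lift : ∃ F : CospanOver J.awfs.cofForget ⥤ J.awfs.Cof,
    F ⋙ J.awfs.cofForget =
      Comma.preRight (𝟭 _) J.awfs.cofForget Arrow.rightFunc ⋙ pullbackFunctor (Cᵒᵖ ⥤ Type u) :=
  exists_lift_cof _
    (fun k => pullbackCoalgebraMap (coalgebraMap k.right) (coalgebraMap_proj k.right) k.hom)
    (fun k => snd_pullbackCoalgebraMap _ _ (comp_coalgebraMap k.right))
    (fun _ => pullbackCoalgebraMap_proj _ _)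
    fun φ => pullbackCoalgebraMap_naturality _ _ _ _ _ _ _ (coalgebraMap_naturality φ.right) _ φ.w

end StableSieves

end UniformFibrations

end

noncomputable section

namespace UniformFibrations

open Opposite

/-! ### Leibniz products and pullback homs -/

section Leibniz

variable {E : Type u} [Category.{v} E] {I G : E ⥤ E}

/-- The component of an endpoint inclusion. -/
def endpoint (d : 𝟭 E ⟶ I) (X : E) : X ⟶ I.obj X :=
  d.app X

lemma endpoint_naturality (d : 𝟭 E ⟶ I) {X Y : E} (f : X ⟶ Y) :
    endpoint d X ≫ I.map f = f ≫ endpoint d Y :=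
  (d.naturality f).symm

section Product

variable [HasPushouts E] (d : 𝟭 E ⟶ I) {A B A' B' : E}

/-- The Leibniz product with an endpoint inclusion. -/
def leib (i : A ⟶ B) : pushout (endpoint d A) i ⟶ I.obj B :=
  pushout.desc (I.map i) (endpoint d B) (endpoint_naturality d i)

lemma inl_leib (i : A ⟶ B) : pushout.inl (endpoint d A) i ≫ leib d i = I.map i :=
  pushout.inl_desc _ _ _

lemma inr_leib (i : A ⟶ B) : pushout.inr (endpoint d A) i ≫ leib d i = endpoint d B :=
  pushout.inr_desc _ _ _

/-- The functoriality of the domain of the Leibniz product. -/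
def leibMap {i : A ⟶ B} {i' : A' ⟶ B'} (p : A ⟶ A') (q : B ⟶ B') (w : p ≫ i' = i ≫ q) :
    pushout (endpoint d A) i ⟶ pushout (endpoint d A') i' :=
  pushout.map _ _ _ _ (I.map p) q p (endpoint_naturality d p) w.symm

variable {i : A ⟶ B} {i' : A' ⟶ B'} (p : A ⟶ A') (q : B ⟶ B') (w : p ≫ i' = i ≫ q)

lemma inl_leibMap :
    pushout.inl (endpoint d A) i ≫ leibMap d p q w = I.map p ≫ pushout.inl (endpoint d A') i' :=
  pushout.inl_desc _ _ _

lemma inr_leibMap :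
    pushout.inr (endpoint d A) i ≫ leibMap d p q w = q ≫ pushout.inr (endpoint d A') i' :=
  pushout.inr_desc _ _ _

lemma leibMap_leib : leibMap d p q w ≫ leib d i' = leib d i ≫ I.map q := by
  ext
  · rw [← Category.assoc, inl_leibMap, Category.assoc, inl_leib, ← Category.assoc, inl_leib,
      ← I.map_comp, ← I.map_comp, w]
  · rw [← Category.assoc, inr_leibMap, Category.assoc, inr_leib, ← Category.assoc, inr_leib,
      endpoint_naturality]

end Product

variable (adj : I ⊣ G) (d : 𝟭 E ⟶ I)

/-- The evaluation at an endpoint of a path. -/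
def evalPath (X : E) : G.obj X ⟶ X :=
  endpoint d (G.obj X) ≫ adj.counit.app X

lemma evalPath_naturality {X Y : E} (f : X ⟶ Y) :
    G.map f ≫ evalPath adj d Y = evalPath adj d X ≫ f := by
  have h : I.map (G.map f) ≫ adj.counit.app Y = adj.counit.app X ≫ f := adj.counit.naturality f
  rw [evalPath, evalPath, ← Category.assoc, ← endpoint_naturality, Category.assoc, h,
    Category.assoc]

/-- Transposition turns evaluation at an endpoint into precomposition with the endpoint inclusion.
This is what matches maps out of the pushout with maps into the pullback. -/
lemma comp_evalPath {B X : E} (h : B ⟶ G.obj X) :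
    h ≫ evalPath adj d X = endpoint d B ≫ (adj.homEquiv B X).symm h := by
  rw [evalPath, adj.homEquiv_counit, ← Category.assoc, ← Category.assoc, endpoint_naturality]

lemma homEquiv_comp_evalPath {B X : E} (h : I.obj B ⟶ X) :
    adj.homEquiv B X h ≫ evalPath adj d X = endpoint d B ≫ h := by
  rw [comp_evalPath, Equiv.symm_apply_apply]

variable [HasPullbacks E] {X Y X' Y' A B : E}

/-- The pullback hom with an endpoint inclusion. -/
def pathLift (f : X ⟶ Y) : G.obj X ⟶ pullback (evalPath adj d Y) f :=
  pullback.lift (G.map f) (evalPath adj d X) (evalPath_naturality adj d f)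

lemma pathLift_fst (f : X ⟶ Y) : pathLift adj d f ≫ pullback.fst _ _ = G.map f :=
  pullback.lift_fst _ _ _

lemma pathLift_snd (f : X ⟶ Y) : pathLift adj d f ≫ pullback.snd _ _ = evalPath adj d X :=
  pullback.lift_snd _ _ _

/-- The functoriality of the codomain of the pullback hom. -/
def pathMap {f : X ⟶ Y} {f' : X' ⟶ Y'} (a : X ⟶ X') (b : Y ⟶ Y') (w : a ≫ f' = f ≫ b) :
    pullback (evalPath adj d Y) f ⟶ pullback (evalPath adj d Y') f' :=
  pullback.map _ _ _ _ (G.map b) a b (evalPath_naturality adj d b).symm w.symm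

section

variable {f : X ⟶ Y} {f' : X' ⟶ Y'} (a : X ⟶ X') (b : Y ⟶ Y') (w : a ≫ f' = f ≫ b)

lemma pathMap_fst :
    pathMap adj d a b w ≫ pullback.fst _ _ = pullback.fst (evalPath adj d Y) f ≫ G.map b :=
  pullback.lift_fst _ _ _

lemma pathMap_snd :
    pathMap adj d a b w ≫ pullback.snd _ _ = pullback.snd (evalPath adj d Y) f ≫ a :=
  pullback.lift_snd _ _ _

lemma map_pathLift : G.map a ≫ pathLift adj d f' = pathLift adj d f ≫ pathMap adj d a b w := by
  refine pullback.hom_ext ?_ ?_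
  · rw [Category.assoc, Category.assoc, pathLift_fst, pathMap_fst, ← Category.assoc, pathLift_fst,
      ← G.map_comp, ← G.map_comp, w]
  · rw [Category.assoc, Category.assoc, pathLift_snd, pathMap_snd, ← Category.assoc, pathLift_snd,
      evalPath_naturality]

end

variable [HasPushouts E] {i : A ⟶ B} {f : X ⟶ Y}

section

variable (s : A ⟶ G.obj X) (t : B ⟶ pullback (evalPath adj d Y) f)
  (w : s ≫ pathLift adj d f = i ≫ t)

/-- The upper side of the transpose of a square to a pullback hom. -/
def transposeLeft : pushout (endpoint d A) i ⟶ X :=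
  pushout.desc ((adj.homEquiv A X).symm s) (t ≫ pullback.snd _ _) (by
    rw [← comp_evalPath, ← pathLift_snd, ← Category.assoc, w, Category.assoc])

/-- The lower side of the transpose of a square to a pullback hom. -/
def transposeRight : I.obj B ⟶ Y :=
  (adj.homEquiv B Y).symm (t ≫ pullback.fst _ _)

lemma inl_transposeLeft :
    pushout.inl _ _ ≫ transposeLeft adj d s t w = (adj.homEquiv A X).symm s :=
  pushout.inl_desc _ _ _

lemma inr_transposeLeft :
    pushout.inr _ _ ≫ transposeLeft adj d s t w = t ≫ pullback.snd _ _ :=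
  pushout.inr_desc _ _ _

lemma transpose_w : transposeLeft adj d s t w ≫ f = leib d i ≫ transposeRight adj d t := by
  ext
  · rw [← Category.assoc, inl_transposeLeft, ← Category.assoc, inl_leib, transposeRight,
      ← adj.homEquiv_naturality_left_symm, ← adj.homEquiv_naturality_right_symm, ← Category.assoc,
      ← w, Category.assoc, pathLift_fst]
  · rw [← Category.assoc, inr_transposeLeft, ← Category.assoc, inr_leib, transposeRight,
      ← comp_evalPath, Category.assoc, Category.assoc, pullback.condition]

variable {s t w} {h : I.obj B ⟶ X}

/-- With `homEquiv_comp_of_filler`: a filler against the Leibniz product transposes to a filler of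
the original square to the pullback hom. -/
lemma comp_homEquiv_of_filler (h₁ : leib d i ≫ h = transposeLeft adj d s t w) :
    i ≫ adj.homEquiv B X h = s := by
  rw [← adj.homEquiv_naturality_left, ← inl_leib d, Category.assoc, h₁, inl_transposeLeft,
    Equiv.apply_symm_apply]

lemma homEquiv_comp_of_filler (h₁ : leib d i ≫ h = transposeLeft adj d s t w)
    (h₂ : h ≫ f = transposeRight adj d t) : adj.homEquiv B X h ≫ pathLift adj d f = t := by
  refine pullback.hom_ext ?_ ?_
  · rw [Category.assoc, pathLift_fst, ← adj.homEquiv_naturality_right, h₂, transposeRight,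
      Equiv.apply_symm_apply]
  · rw [Category.assoc, pathLift_snd, homEquiv_comp_evalPath, ← inr_leib d i, Category.assoc, h₁,
      inr_transposeLeft]

end

section

variable (s : pushout (endpoint d A) i ⟶ X) (t : I.obj B ⟶ Y) (w : s ≫ f = leib d i ≫ t)

/-- The upper side of the transpose of a square from a Leibniz product. -/
def untransposeLeft : A ⟶ G.obj X :=
  adj.homEquiv A X (pushout.inl _ _ ≫ s)

/-- The lower side of the transpose of a square from a Leibniz product. -/
def untransposeRight : B ⟶ pullback (evalPath adj d Y) f :=
  pullback.lift (adj.homEquiv B Y t) (pushout.inr _ _ ≫ s) (by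
    rw [homEquiv_comp_evalPath, Category.assoc, w, ← Category.assoc, inr_leib])

lemma untransposeRight_fst :
    untransposeRight adj d s t w ≫ pullback.fst _ _ = adj.homEquiv B Y t :=
  pullback.lift_fst _ _ _

lemma untransposeRight_snd :
    untransposeRight adj d s t w ≫ pullback.snd _ _ = pushout.inr _ _ ≫ s :=
  pullback.lift_snd _ _ _

lemma untranspose_w :
    untransposeLeft adj d s ≫ pathLift adj d f = i ≫ untransposeRight adj d s t w := by
  refine pullback.hom_ext ?_ ?_
  · rw [Category.assoc, pathLift_fst, Category.assoc, untransposeRight_fst, untransposeLeft,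
      ← adj.homEquiv_naturality_left, ← adj.homEquiv_naturality_right, Category.assoc, w,
      ← Category.assoc, inl_leib]
  · rw [Category.assoc, pathLift_snd, Category.assoc, untransposeRight_snd, untransposeLeft,
      homEquiv_comp_evalPath, ← Category.assoc, pushout.condition, Category.assoc]

variable {s t w} {h : B ⟶ G.obj X}

/-- With `homEquiv_symm_comp_of_filler`, the converse passage from fillers of the pullback hom to
fillers against the Leibniz product. -/
lemma leib_comp_of_filler (h₁ : i ≫ h = untransposeLeft adj d s)
    (h₂ : h ≫ pathLift adj d f = untransposeRight adj d s t w) :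
    leib d i ≫ (adj.homEquiv B X).symm h = s := by
  ext
  · rw [← Category.assoc, inl_leib, ← adj.homEquiv_naturality_left_symm, h₁, untransposeLeft,
      Equiv.symm_apply_apply]
  · rw [← Category.assoc, inr_leib, ← comp_evalPath, ← pathLift_snd adj d f, ← Category.assoc, h₂,
      untransposeRight_snd]

lemma homEquiv_symm_comp_of_filler (h₂ : h ≫ pathLift adj d f = untransposeRight adj d s t w) :
    (adj.homEquiv B X).symm h ≫ f = t := by
  rw [← adj.homEquiv_naturality_right_symm, ← pathLift_fst adj d f, ← Category.assoc, h₂,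
    untransposeRight_fst, Equiv.symm_apply_apply]

end

end Leibniz

end UniformFibrations

end

/-! ### Naturality of transposition, and pullback squares between Leibniz products. -/

noncomputable section

namespace UniformFibrations

open Opposite

section

variable {E : Type u} [Category.{v} E] {I G : E ⥤ E} (adj : I ⊣ G) (d : 𝟭 E ⟶ I)
  {A B A' B' X Y X' Y' : E} {i : A ⟶ B} {i' : A' ⟶ B'} {f : X ⟶ Y} {f' : X' ⟶ Y'}

lemma comp_untransposeLeft [HasPushouts E] (s : pushout (endpoint d A) i ⟶ X) (s' : pushout (endpoint d A') i' ⟶ X')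
    (p : A ⟶ A') (q : B ⟶ B') (w' : p ≫ i' = i ≫ q) (a : X ⟶ X')
    (h : s ≫ a = leibMap d p q w' ≫ s') :
    untransposeLeft adj d s ≫ G.map a = p ≫ untransposeLeft adj d s' := by
  rw [untransposeLeft, untransposeLeft, ← adj.homEquiv_naturality_right,
    ← adj.homEquiv_naturality_left, Category.assoc, h, ← Category.assoc, inl_leibMap,
    Category.assoc]

variable [HasPullbacks E] (s : A ⟶ G.obj X) (t : B ⟶ pullback (evalPath adj d Y) f)
  (w : s ≫ pathLift adj d f = i ≫ t)

lemma map_transposeRight (q : B' ⟶ B) :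
    I.map q ≫ transposeRight adj d t = transposeRight adj d (q ≫ t) := by
  rw [transposeRight, transposeRight, Category.assoc, ← adj.homEquiv_naturality_left_symm]

lemma transposeRight_comp (a : X ⟶ X') (b : Y ⟶ Y') (w' : a ≫ f' = f ≫ b) :
    transposeRight adj d t ≫ b = transposeRight adj d (t ≫ pathMap adj d a b w') := by
  rw [transposeRight, transposeRight, Category.assoc, pathMap_fst, ← Category.assoc,
    adj.homEquiv_naturality_right_symm]

variable [HasPushouts E]

lemma leibMap_transposeLeft (p : A' ⟶ A) (q : B' ⟶ B) (w' : p ≫ i = i' ≫ q) :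
    leibMap d p q w' ≫ transposeLeft adj d s t w = transposeLeft adj d (p ≫ s) (q ≫ t)
      (by rw [Category.assoc, w, ← Category.assoc, w', Category.assoc]) := by
  ext
  · rw [← Category.assoc, inl_leibMap, Category.assoc, inl_transposeLeft, inl_transposeLeft,
      adj.homEquiv_naturality_left_symm]
  · rw [← Category.assoc, inr_leibMap, Category.assoc, inr_transposeLeft, inr_transposeLeft,
      Category.assoc]

lemma transposeLeft_comp (a : X ⟶ X') (b : Y ⟶ Y') (w' : a ≫ f' = f ≫ b) :
    transposeLeft adj d s t w ≫ a =
      transposeLeft adj d (s ≫ G.map a) (t ≫ pathMap adj d a b w')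
        (by rw [Category.assoc, map_pathLift adj d a b w', ← Category.assoc, w, Category.assoc]) := by
  ext
  · rw [← Category.assoc, inl_transposeLeft, inl_transposeLeft,
      adj.homEquiv_naturality_right_symm]
  · rw [← Category.assoc, inr_transposeLeft, inr_transposeLeft, Category.assoc, Category.assoc,
      pathMap_snd]

lemma comp_untransposeRight (s : pushout (endpoint d A) i ⟶ X)
    (s' : pushout (endpoint d A') i' ⟶ X') (t : I.obj B ⟶ Y) (t' : I.obj B' ⟶ Y')
    (w : s ≫ f = leib d i ≫ t) (w₁ : s' ≫ f' = leib d i' ≫ t')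
    (p : A ⟶ A') (q : B ⟶ B') (w' : p ≫ i' = i ≫ q) (a : X ⟶ X') (b : Y ⟶ Y')
    (w'' : a ≫ f' = f ≫ b) (h : s ≫ a = leibMap d p q w' ≫ s') (h' : t ≫ b = I.map q ≫ t') :
    untransposeRight adj d s t w ≫ pathMap adj d a b w'' =
      q ≫ untransposeRight adj d s' t' w₁ := by
  refine pullback.hom_ext ?_ ?_
  · rw [Category.assoc, pathMap_fst, ← Category.assoc, untransposeRight_fst, Category.assoc,
      untransposeRight_fst, ← adj.homEquiv_naturality_right, h', adj.homEquiv_naturality_left]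
  · rw [Category.assoc, pathMap_snd, ← Category.assoc, untransposeRight_snd, Category.assoc,
      Category.assoc, untransposeRight_snd, h, ← Category.assoc, inr_leibMap, Category.assoc]

end

variable {C : Type u} [SmallCategory C]

section

variable {I : (Cᵒᵖ ⥤ Type u) ⥤ Cᵒᵖ ⥤ Type u} (d : 𝟭 _ ⟶ I)
  {A B A' B' : Cᵒᵖ ⥤ Type u}

lemma inl_or_inr (i : A ⟶ B) {c : C} (x : (pushout (endpoint d A) i).obj (op c)) :
    (∃ a, (pushout.inl (endpoint d A) i).app (op c) a = x) ∨
      ∃ b, (pushout.inr (endpoint d A) i).app (op c) b = x :=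
  Types.eq_or_eq_of_isPushout
    ((IsPushout.of_hasPushout (endpoint d A) i).map ((evaluation _ _).obj (op c))) x

/-- Uniqueness is monicity of `leib d i`. For existence, an element of the pushout comes from `I.obj
A'` or from `B'`: the first kind lifts because `I` preserves the given pullback, the second because
the naturality squares of `d` are pullbacks. -/
lemma leib_isPullback [PreservesLimitsOfShape WalkingCospan I] (hd : NatTrans.Equifibered d)
    {i : A ⟶ B} {i' : A' ⟶ B'} [Mono (leib d i)] {p : A ⟶ A'} {q : B ⟶ B'}
    (h : IsPullback p i i' q) : IsPullback (leibMap d p q h.w) (leib d i) (leib d i') (I.map q) := by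
  rw [isPullback_iff_elementwise]
  refine ⟨leibMap_leib _ _ _ _, fun c => ⟨fun x y _ e => app_injective (leib d i) c e, ?_⟩⟩
  intro x y e
  obtain ⟨a, rfl⟩ | ⟨b, rfl⟩ := inl_or_inr d i' x
  · have e' : (I.map i').app (op c) a = (I.map q).app (op c) y := by
      rw [← e, ← inl_leib d i']
      rfl
    obtain ⟨z, rfl, rfl⟩ := ((isPullback_iff_elementwise.1 (h.map I)).2 c).2 a y e'
    refine ⟨(pushout.inl (endpoint d A) i).app (op c) z, ?_, ?_⟩
    · exact congrArg (fun k => k.app (op c) z) (inl_leibMap d p q h.w)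
    · exact congrArg (fun k => k.app (op c) z) (inl_leib d i)
  · have e' : (endpoint d B').app (op c) b = (I.map q).app (op c) y := by
      rw [← e, ← inr_leib d i']
      rfl
    obtain ⟨z, rfl, rfl⟩ := ((isPullback_iff_elementwise.1 (hd q)).2 c).2 b y e'
    refine ⟨(pushout.inr (endpoint d A) i).app (op c) z, ?_, ?_⟩
    · exact congrArg (fun k => k.app (op c) z) (inr_leibMap d p q h.w)
    · exact congrArg (fun k => k.app (op c) z) (inr_leib d i)

end

/-! ### Pullback homs of algebras -/

lemma SieveAlg.diag_congr {J : StableSieves C} {A B X Y : Cᵒᵖ ⥤ Type u} {f : X ⟶ Y}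
    (α : SieveAlg J f) (m : A ⟶ B) [Mono m]
    (hm : ∀ {c : C} (b : B.obj (op c)), J.mem (sieveOf m b)) {s s' : A ⟶ X} {t t' : B ⟶ Y}
    (hs : s = s') (ht : t = t') (w : s ≫ f = m ≫ t) (w' : s' ≫ f = m ≫ t') :
    α.diag m hm s t w = α.diag m hm s' t' w' := by
  subst hs ht
  rfl

/-- A class of monos, stable under base change and under the Leibniz product with an endpoint
inclusion of a left adjoint which is compatible with pullbacks. -/
structure LeibnizStable (M : MorphismProperty (Cᵒᵖ ⥤ Type u))
    {I : (Cᵒᵖ ⥤ Type u) ⥤ Cᵒᵖ ⥤ Type u} (d : 𝟭 _ ⟶ I) : Prop where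
  mono : M ≤ MorphismProperty.monomorphisms _
  preserves : PreservesLimitsOfShape WalkingCospan I
  equifibered : NatTrans.Equifibered d
  leib : ∀ {A B : Cᵒᵖ ⥤ Type u} (i : A ⟶ B), M i → M (leib d i)

namespace LeibnizStable

variable {M : MorphismProperty (Cᵒᵖ ⥤ Type u)} {I G : (Cᵒᵖ ⥤ Type u) ⥤ Cᵒᵖ ⥤ Type u}
  {d : 𝟭 _ ⟶ I}

lemma mono_leib (H : LeibnizStable M d) {A B : Cᵒᵖ ⥤ Type u} {i : A ⟶ B} (hi : M i) :
    Mono (UniformFibrations.leib d i) :=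
  H.mono _ (H.leib _ hi)

variable [M.IsStableUnderBaseChange]

lemma mem_leib (H : LeibnizStable M d) {A B : Cᵒᵖ ⥤ Type u} {i : A ⟶ B} (hi : M i) {c : C}
    (b : (I.obj B).obj (op c)) : (sievesOf M).mem (sieveOf (UniformFibrations.leib d i) b) :=
  haveI := H.mono_leib hi
  mem_sieveOf (H.leib _ hi) b

variable (H : LeibnizStable M d) (adj : I ⊣ G)

section

variable {A B A' B' X Y X' Y' : Cᵒᵖ ⥤ Type u} {f : X ⟶ Y} {f' : X' ⟶ Y'}
  (α : SieveAlg (sievesOf M) f) {i : A ⟶ B} (hi : M i) (s : A ⟶ G.obj X)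
  (t : B ⟶ pullback (evalPath adj d Y) f) (w : s ≫ pathLift adj d f = i ≫ t)

/-- The transpose of the filler of a square to the pullback hom of an algebra. -/
def pathFiller : I.obj B ⟶ X :=
  haveI := H.mono_leib hi
  α.diag (UniformFibrations.leib d i) (H.mem_leib hi)
    (transposeLeft adj d s t w) (transposeRight adj d t) (transpose_w adj d _ _ _)

lemma leib_pathFiller : UniformFibrations.leib d i ≫ H.pathFiller adj α hi s t w =
    transposeLeft adj d s t w := by
  have := H.mono_leib hi
  exact α.comp_diag _ (H.mem_leib hi) _ _ _

lemma pathFiller_comp : H.pathFiller adj α hi s t w ≫ f = transposeRight adj d t := by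
  have := H.mono_leib hi
  exact α.diag_comp _ (H.mem_leib hi) _ _ _

/-- The Leibniz product of the pullback square is again a pullback square, so fillers of the algebra
are natural along it. This becomes the naturality of `pathRightMap`. -/
lemma map_pathFiller {i' : A' ⟶ B'} (hi' : M i') {p : A' ⟶ A} {q : B' ⟶ B}
    (h : IsPullback p i' i q) (w' : (p ≫ s) ≫ pathLift adj d f = i' ≫ q ≫ t) :
    I.map q ≫ H.pathFiller adj α hi s t w = H.pathFiller adj α hi' (p ≫ s) (q ≫ t) w' := by
  have := H.mono_leib hi
  have := H.mono_leib hi'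
  have := H.preserves
  refine (α.diag_of_isPullback _ (H.mem_leib hi) _ _ _ _ (H.mem_leib hi')
    (leib_isPullback d H.equifibered h) ?_).trans ?_
  · rw [leibMap_transposeLeft, map_transposeRight]
    exact transpose_w adj d _ _ _
  · exact α.diag_congr _ (H.mem_leib hi') (leibMap_transposeLeft _ _ _ _ _ _ _ _)
      (map_transposeRight _ _ _ _) _ _

lemma pathFiller_comp_left {β : SieveAlg (sievesOf M) f'} {a : X ⟶ X'} {b : Y ⟶ Y'}
    (h : α.IsHom β a b)
    (w' : (s ≫ G.map a) ≫ pathLift adj d f' = i ≫ t ≫ pathMap adj d a b h.w) :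
    H.pathFiller adj α hi s t w ≫ a =
      H.pathFiller adj β hi (s ≫ G.map a) (t ≫ pathMap adj d a b h.w) w' := by
  have := H.mono_leib hi
  refine (h.diag_comp _ (H.mem_leib hi) _ _ _ ?_).trans ?_
  · rw [transposeLeft_comp _ _ _ _ _ _ _ h.w, transposeRight_comp _ _ _ _ _ h.w]
    exact transpose_w adj d _ _ _
  · exact β.diag_congr _ (H.mem_leib hi) (transposeLeft_comp _ _ _ _ _ _ _ h.w)
      (transposeRight_comp _ _ _ _ _ h.w) _ _

end

/-- The pullback hom of an algebra, as a right map. -/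
def pathRightMap (f : SieveAlgCat (sievesOf M)) : RightMap (CartSubcategory.incl M) where
  arrow := Arrow.mk (pathLift adj d f.arrow.hom)
  lift i sq := adj.homEquiv _ _ (H.pathFiller adj f.alg i.2 sq.left sq.right (Arrow.w sq))
  fac_left _ _ := comp_homEquiv_of_filler adj d (H.leib_pathFiller adj _ _ _ _ _)
  fac_right _ _ := homEquiv_comp_of_filler adj d (H.leib_pathFiller adj _ _ _ _ _)
    (H.pathFiller_comp adj _ _ _ _ _)
  naturality σ _ := (adj.homEquiv_naturality_left _ _).symm.trans
    (congrArg _ (H.map_pathFiller adj _ _ _ _ _ _ σ.hom.2 _))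

/-- The functoriality of the pullback hom of an algebra. -/
def pathHom {f g : SieveAlgCat (sievesOf M)} (φ : f ⟶ g) :
    H.pathRightMap adj f ⟶ H.pathRightMap adj g where
  sq := Arrow.homMk (f := Arrow.mk (pathLift adj d f.arrow.hom))
    (g := Arrow.mk (pathLift adj d g.arrow.hom)) (u := G.map φ.sq.left)
    (v := pathMap adj d φ.sq.left φ.sq.right (Arrow.w φ.sq)) (map_pathLift _ _ _ _ _)
  lift_comp _ _ := (adj.homEquiv_naturality_right _ _).symm.trans
    (congrArg _ (H.pathFiller_comp_left adj _ _ _ _ _ φ.isHom _))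

/-- The pullback hom of an algebra, as an algebra. -/
def pathAlg {X Y : Cᵒᵖ ⥤ Type u} {f : X ⟶ Y} (α : SieveAlg (sievesOf M) f) :
    SieveAlg (sievesOf M) (pathLift adj d f) :=
  sieveDenseIncl.sieveAlgOfRightMap (H.pathRightMap adj ⟨Arrow.mk f, α⟩)

lemma pathAlg_isHom {X Y X' Y' : Cᵒᵖ ⥤ Type u} {f : X ⟶ Y} {f' : X' ⟶ Y'}
    {α : SieveAlg (sievesOf M) f} {β : SieveAlg (sievesOf M) f'} {a : X ⟶ X'} {b : Y ⟶ Y'}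
    (h : α.IsHom β a b) :
    (H.pathAlg adj α).IsHom (H.pathAlg adj β) (G.map a) (pathMap adj d a b h.w) :=
  SieveAlgCat.Hom.isHom (sieveDenseIncl.ofRightMap.map (H.pathHom adj
    (show (⟨Arrow.mk f, α⟩ : SieveAlgCat (sievesOf M)) ⟶ ⟨Arrow.mk f', β⟩ from
      ⟨Arrow.homMk (f := Arrow.mk f) (g := Arrow.mk f') (u := a) (v := b) h.w, h⟩)))

/-! ### Leibniz products of coalgebras -/

section

variable {A B A' B' : Cᵒᵖ ⥤ Type u} {i : A ⟶ B} {i' : A' ⟶ B'}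

lemma leaf_leib_w (i : A ⟶ B) :
    free.leaf (sievesOf M) (UniformFibrations.leib d i) ≫ free.proj _ _ =
      UniformFibrations.leib d i ≫ 𝟙 _ := by
  rw [free.leaf_proj, Category.comp_id]

/-- The comparison map from the free algebra to the path object of the free algebra on the Leibniz
product. -/
def freeToPath (i : A ⟶ B) :
    free (sievesOf M) i ⟶ G.obj (free (sievesOf M) (UniformFibrations.leib d i)) :=
  free.lift (H.pathAlg adj (free.alg _ _)) (untransposeLeft adj d (free.leaf _ _))
    (untransposeRight adj d (free.leaf _ _) (𝟙 _) (leaf_leib_w i)) (untranspose_w adj d _ _ _)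

lemma leaf_freeToPath (i : A ⟶ B) : free.leaf (sievesOf M) i ≫ H.freeToPath adj i =
    untransposeLeft adj d (free.leaf _ _) :=
  free.leaf_lift _ _ _ _

lemma freeToPath_isHom (i : A ⟶ B) :
    (free.alg (sievesOf M) i).IsHom (H.pathAlg adj (free.alg _ _)) (H.freeToPath adj i)
      (untransposeRight adj d (free.leaf _ _) (𝟙 _) (leaf_leib_w i)) :=
  free.lift_isHom _ _ _ _

lemma freeToPath_naturality (p : A ⟶ A') (q : B ⟶ B') (w : p ≫ i' = i ≫ q) :
    H.freeToPath adj i ≫ G.map (free.map _ (leibMap d p q w) (I.map q) (leibMap_leib d p q w)) =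
      free.map _ p q w ≫ H.freeToPath adj i' := by
  have e := free.leaf_map (J := sievesOf M) _ _ (leibMap_leib d p q w)
  have h₁ := (H.freeToPath_isHom adj i).comp
    (H.pathAlg_isHom adj (free.map_isHom _ _ (leibMap_leib d p q w)))
  -- Uniqueness requires both homomorphisms to lie over the same base map, so the base map of `h₁`
  -- is rewritten.
  rw [comp_untransposeRight adj d _ _ _ _ _ (leaf_leib_w i') p q w _ _ _ e
    ((Category.id_comp _).trans (Category.comp_id _).symm)] at h₁
  refine free.hom_ext h₁ ((free.map_isHom p q w).comp (H.freeToPath_isHom adj i')) ?_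
  rw [← Category.assoc, leaf_freeToPath, free.leaf_map_assoc, leaf_freeToPath,
    comp_untransposeLeft adj d _ _ p q w _ e]

variable (l : B ⟶ free (sievesOf M) i)

/-- The Leibniz product of a coalgebra structure map. -/
def leibCoalgebraMap : I.obj B ⟶ free (sievesOf M) (UniformFibrations.leib d i) :=
  (adj.homEquiv _ _).symm (l ≫ H.freeToPath adj i)

lemma comp_freeToPath_comp (hp : l ≫ free.proj _ i = 𝟙 B) :
    (l ≫ H.freeToPath adj i) ≫ pathLift adj d _ =
      untransposeRight adj d (free.leaf _ _) (𝟙 _) (leaf_leib_w i) := by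
  rw [Category.assoc, (H.freeToPath_isHom adj i).w, ← Category.assoc, hp, Category.id_comp]

/-- Transpose the square from the Leibniz product to its `proj` with sides `leaf` and the identity:
`l ≫ H.freeToPath adj i` fills it. Transposing back fills the original square, whose two triangles
are the coalgebra conditions here and in `leibCoalgebraMap_proj`. -/
lemma leib_leibCoalgebraMap (hl : i ≫ l = free.leaf _ i) (hp : l ≫ free.proj _ i = 𝟙 B) :
    UniformFibrations.leib d i ≫ H.leibCoalgebraMap adj l = free.leaf _ _ :=
  leib_comp_of_filler adj d (by rw [← Category.assoc, hl, leaf_freeToPath])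
    (H.comp_freeToPath_comp adj l hp)

lemma leibCoalgebraMap_proj (hp : l ≫ free.proj _ i = 𝟙 B) :
    H.leibCoalgebraMap adj l ≫ free.proj _ _ = 𝟙 _ :=
  homEquiv_symm_comp_of_filler adj d (H.comp_freeToPath_comp adj l hp)

lemma leibCoalgebraMap_naturality (l' : B' ⟶ free (sievesOf M) i') (p : A ⟶ A') (q : B ⟶ B')
    (w : p ≫ i' = i ≫ q) (e : l ≫ free.map _ p q w = q ≫ l') :
    H.leibCoalgebraMap adj l ≫
        free.map _ (leibMap d p q w) (I.map q) (leibMap_leib d p q w) =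
      I.map q ≫ H.leibCoalgebraMap adj l' := by
  rw [leibCoalgebraMap, leibCoalgebraMap, ← adj.homEquiv_naturality_right_symm,
    ← adj.homEquiv_naturality_left_symm, Category.assoc, freeToPath_naturality, ← Category.assoc, e,
    Category.assoc]

end

end LeibnizStable

end UniformFibrations

end

/-! ### The lifts for the given cylinder, and the main theorem. -/

noncomputable section

namespace UniformFibrations

open Opposite

variable {C : Type u} [SmallCategory C] {M : MorphismProperty (Cᵒᵖ ⥤ Type u)}
  [M.IsStableUnderBaseChange]

/-- Connects the general Leibniz bifunctor with the explicit pushout; the two actions on squares are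
compared on the pushout inclusions. -/
lemma leibniz_map_left (Cyl : FunctorialCylinder (Cᵒᵖ ⥤ Type u)) (k : Fin 2)
    {i i' : Arrow (Cᵒᵖ ⥤ Type u)} (φ : i ⟶ i') :
    ((Cyl.leibniz k).map φ).left = leibMap (Cyl.δ k) φ.left φ.right (Arrow.w φ) := by
  refine pushout.hom_ext ?_ ?_
  · exact ((IsPushout.of_hasPushout (endpoint (Cyl.δ k) i.left) i.hom).inl_desc _ _ _).trans
      (inl_leibMap _ _ _ _).symm
  · exact ((IsPushout.of_hasPushout (endpoint (Cyl.δ k) i.left) i.hom).inr_desc _ _ _).trans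
      (inr_leibMap _ _ _ _).symm

lemma LeibnizStable.exists_leibniz_lift (Cyl : FunctorialCylinder (Cᵒᵖ ⥤ Type u)) (k : Fin 2)
    (H : LeibnizStable M (Cyl.δ k)) {G : (Cᵒᵖ ⥤ Type u) ⥤ Cᵒᵖ ⥤ Type u} (adj : Cyl.cyl ⊣ G) :
    ∃ F : (sievesOf M).awfs.Cof ⥤ (sievesOf M).awfs.Cof,
      F ⋙ (sievesOf M).awfs.cofForget = (sievesOf M).awfs.cofForget ⋙ Cyl.leibniz k := by
  refine StableSieves.exists_lift_cof _
    (fun c => H.leibCoalgebraMap adj (StableSieves.coalgebraMap c))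
    (fun c => H.leib_leibCoalgebraMap adj _ (StableSieves.comp_coalgebraMap c)
      (StableSieves.coalgebraMap_proj c))
    (fun c => H.leibCoalgebraMap_proj adj _ (StableSieves.coalgebraMap_proj c))
    fun {c c'} φ => ?_
  refine Eq.trans ?_ (H.leibCoalgebraMap_naturality adj _ _ _ _ _
    (StableSieves.coalgebraMap_naturality φ))
  congr 2
  exact leibniz_map_left Cyl k φ.hom.f

lemma sieveOf_initial_to {X : Cᵒᵖ ⥤ Type u} {c : C} (x : X.obj (op c)) :
    sieveOf (initial.to X) x = ⊥ := by
  ext d g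
  refine ⟨fun ⟨a, _⟩ => ?_, fun h => h.elim⟩
  -- A map from the initial presheaf to the constant empty presheaf shows that the former has no
  -- elements.
  exact ((initial.to ((Functor.const Cᵒᵖ).obj PEmpty)).app (op d) a).elim

lemma bot_mem_sievesOf (M1 : M ≤ MorphismProperty.monomorphisms _)
    (M2 : ∀ X : Cᵒᵖ ⥤ Type u, M (initial.to X)) (c : C) : (sievesOf M).mem (⊥ : Sieve c) := by
  have : Mono (initial.to (yoneda.obj c)) := M1 _ (M2 _)
  rw [← sieveOf_initial_to (X := yoneda.obj c) (𝟙 c)]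
  exact mem_sieveOf (M2 _) _

end UniformFibrations

end

open UniformFibrations in
theorem mainTheorem6 {C : Type u} [SmallCategory C]
    (Cyl : FunctorialCylinder (Cᵒᵖ ⥤ Type u))
    (contr : Cyl.Contractions) (conn : FunctorialCylinder.Connections contr)
    (adj : Cyl.cyl.IsLeftAdjoint)
    (C1 : PreservesLimitsOfShape WalkingCospan Cyl.cyl)
    (C2 : ∀ k : Fin 2, NatTrans.Equifibered (Cyl.δ k))
    (M : MorphismProperty (Cᵒᵖ ⥤ Type u))
    (M1 : M ≤ MorphismProperty.monomorphisms (Cᵒᵖ ⥤ Type u))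
    (M2 : ∀ X : Cᵒᵖ ⥤ Type u, M (initial.to X))
    (M3 : M.IsStableUnderBaseChange)
    (M4 : ∀ (k : Fin 2) (i : Arrow (Cᵒᵖ ⥤ Type u)), M i.hom → M ((Cyl.leibniz k).obj i).hom) :
    ∃ W : AWFS (Cᵒᵖ ⥤ Type u),
      AWFS.IsSuitable.{u} W Cyl ∧ W.AlgebraicallyFree (CartSubcategory.incl M) := by
  have hM (k : Fin 2) : LeibnizStable M (Cyl.δ k) :=
    ⟨M1, C1, C2 k, fun i hi => M4 k (Arrow.mk i) hi⟩
  exact ⟨(sievesOf M).awfs,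
    { cofibrantlyGenerated := cofibrantlyGenerated_awfs M1
      bot := StableSieves.exists_bot_lift (bot_mem_sievesOf M1 M2)
      pullback := StableSieves.exists_pullback_lift
      leibniz := fun k => (hM k).exists_leibniz_lift Cyl k (Adjunction.ofIsLeftAdjoint Cyl.cyl) },
    algebraicallyFree_incl M1⟩
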